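/- Let $K$ be a field of characteristic $0$. A filtration $s$ of a Lie algebra $\mathfrak g$ over $K$ is a chain of ideals $\mathfrak g=\mathfrak g_0\supseteq\mathfrak g_1\supseteq\dots\supseteq\mathfrak g_k=0$ with $\dim \mathfrak g_{i-1}/\mathfrak g_i\le 1$ (so $\mathfrak g$ is finite-dimensional and solvable); fix one. A $U(\mathfrak g,s)$-module is a $\mathfrak g$-module $V$ with a chain of subspaces $V=V_0\supseteq V_1\supseteq\dots\supseteq V_k$ such that $V_i$ is stable under $\mathfrak g_i$. It is irreducible if each $V_i$ is an irreducible $\mathfrak g_i$-module, and an equivalence $V\to T$ is a $\mathfrak g$-isomorphism carrying each $V_i$ onto $T_i$. A $\mathfrak g$-submodule $W$ carries the filtration $W_i=V_i\cap W$ and the quotient $V/W$ the filtration by the images of the $V_i$. A subfactor of $V$ is a $U(\mathfrak g,s)$-module equivalent to $W/W'$ for some submodules $W\supseteq W'$ of $V$, a factor is one equivalent to $V/Z$ for some submodule $Z$, and $\operatorname{Spec}(V)$ is the set of equivalence classes of irreducible subfactors of $V$. A subalgebra $\mathfrak h\subseteq\mathfrak g$ carries the filtration $\mathfrak h_i=\mathfrak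 g_i\cap\mathfrak h$, and for a $U(\mathfrak h,s)$-module $W$ the induced module $\operatorname{ind}(W,\mathfrak g)=U(\mathfrak g)\otimes_{U(\mathfrak h)}W$ is filtered by the subspaces $\operatorname{ind}(W_i,\mathfrak g_i)$ (spanned by the $u\otimes w$ with $u\in U(\mathfrak g_i)$, $w\in W_i$). For $f\in\mathfrak g^*$ with restrictions $f_i=f|_{\mathfrak g_i}$, the Vergne polarization is $\mathfrak{pv}(f)=\sum_i \mathfrak g_i^{f_i}$, where $\mathfrak g_i^{f_i}=\{x\in\mathfrak g_i: f([x,\mathfrak g_i])=0\}$. Let $M_s(f)=\operatorname{ind}(f|_{\mathfrak{pv}(f)},\mathfrak g)$, filtered by the $\operatorname{ind}(f_i|_{\mathfrak{pv}(f)\cap\mathfrak g_i},\mathfrak g_i)$, and let $\mathfrak R(f)$ be the set of all $f'\in\mathfrak g^*$ with $\mathfrak{pv}(f')=\mathfrak{pv}(f)$ that agree with $f$ on $\mathfrak{pv}(f)$. For $h\in\mathfrak h^*$ let $N_s(h)$ and $\mathfrak r(h)\subseteq\mathfrak h^*$ be the corresponding $U(\mathfrak h,s)$-module and class for $(\mathfrak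 h,s)$. Let $\pi:\mathfrak g^*\to\mathfrak h^*$ be the restriction map. Theorem 4.3. Let $\mathfrak h$ be a subalgebra of $\mathfrak g$ and $h\in\mathfrak h^*$. 1. For every $f\in\mathfrak g^*$, $M_s(f)$ belongs to $\operatorname{Spec}(\operatorname{ind}(N_s(h),\mathfrak g))$ if and only if $\mathfrak R(f)\subseteq\pi^{-1}(\mathfrak r(h))$. 2. Every irreducible subfactor of $\operatorname{ind}(N_s(h),\mathfrak g)$ is a factor of $\operatorname{ind}(N_s(h),\mathfrak g)$. 3. If $K$ is algebraically closed, then $$\operatorname{Spec}(\operatorname{ind}(N_s(h),\mathfrak g))=\{M_s(f)\mid f\in\mathfrak g^*,\ \mathfrak R(f)\subseteq\pi^{-1}(\mathfrak r(h))\}$$ (as sets of equivalence classes). -/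

import Mathlib

open scoped TensorProduct

universe u v w w'

/-! ### Lie algebras with filtrations -/

/-- A filtration `g = g₀ ⊇ g₁ ⊇ ⋯ ⊇ g_k = 0` of a Lie algebra by ideals, in which each ideal has
codimension at most one in its predecessor (repetitions are allowed).  A Lie algebra carrying such
a filtration is automatically finite dimensional and solvable. -/
structure LieFiltration (K : Type u) (g : Type v) [Field K] [LieRing g] [LieAlgebra K g]
    (k : ℕ) where
  ideal : Fin (k + 1) → LieIdeal K g
  antitone : ∀ i j, i ≤ j → ideal j ≤ ideal i
  ideal_zero : ideal 0 = ⊤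
  ideal_last : ideal (Fin.last k) = ⊥
  codim_le : ∀ i : Fin k,
    Module.rank K (↥(ideal i.castSucc).toSubmodule ⧸
      (ideal i.succ).toSubmodule.submoduleOf (ideal i.castSucc).toSubmodule) ≤ 1

namespace LieFiltration

section Restrict

variable {K : Type u} {g : Type v} [Field K] [LieRing g] [LieAlgebra K g] {k : ℕ}

/-- The filtration `g₀ ∩ h ⊇ ⋯ ⊇ g_k ∩ h` induced on a subalgebra `h`. -/
def restrict (s : LieFiltration K g k) (h : LieSubalgebra K g) : LieFiltration K h k where
  ideal i := (s.ideal i).comap h.incl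
  antitone i j hij := LieIdeal.comap_mono (s.antitone i j hij)
  ideal_zero := by
    ext x
    simp [LieIdeal.mem_comap, s.ideal_zero]
  ideal_last := by
    ext x
    simp [LieIdeal.mem_comap, s.ideal_last]
  codim_le i := by
    refine le_trans ?_ (s.codim_le i)
    set A := (s.ideal i.castSucc).toSubmodule
    set B := (s.ideal i.succ).toSubmodule
    let φ : ↥((s.ideal i.castSucc).comap h.incl).toSubmodule →ₗ[K] A :=
      { toFun := fun x => ⟨((x : h) : g), x.2⟩
        map_add' := fun _ _ => rfl
        map_smul' := fun _ _ => rfl }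
    have hφ : ((s.ideal i.succ).comap h.incl).toSubmodule.submoduleOf
        ((s.ideal i.castSucc).comap h.incl).toSubmodule ≤ (B.submoduleOf A).comap φ :=
      fun x hx => hx
    refine LinearMap.rank_le_of_injective
      (Submodule.mapQ (((s.ideal i.succ).comap h.incl).toSubmodule.submoduleOf
        ((s.ideal i.castSucc).comap h.incl).toSubmodule) (B.submoduleOf A) φ
        hφ) ?_
    rw [← LinearMap.ker_eq_bot, LinearMap.ker_eq_bot']
    intro x
    induction x using Submodule.Quotient.induction_on with
    | H x =>
      intro hx
      rw [Submodule.mapQ_apply, Submodule.Quotient.mk_eq_zero] at hx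
      rw [Submodule.Quotient.mk_eq_zero]
      exact hx

end Restrict

end LieFiltration

/-! ### Modules with filtrations -/

section FilteredModule

variable {K : Type u} {g : Type v} [Field K] [LieRing g] [LieAlgebra K g] {k : ℕ}

/-- A filtration `V = V₀ ⊇ V₁ ⊇ ⋯ ⊇ V_k` of a `g`-module `V` such that each `V_i` is stable under
`g_i`; with it, `V` is a module over the Lie algebra with filtration `(g, s)`. -/
structure ModuleFiltration (s : LieFiltration K g k) (V : Type w) [AddCommGroup V] [Module K V]
    [LieRingModule g V] [LieModule K g V] where
  sub : ∀ i : Fin (k + 1), LieSubmodule K (s.ideal i) V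
  antitone : ∀ i j, i ≤ j → (sub j).toSubmodule ≤ (sub i).toSubmodule
  sub_zero : (sub 0).toSubmodule = ⊤

namespace ModuleFiltration

variable {s : LieFiltration K g k}
variable {V : Type w} [AddCommGroup V] [Module K V] [LieRingModule g V] [LieModule K g V]
variable {T : Type w'} [AddCommGroup T] [Module K T] [LieRingModule g T] [LieModule K g T]

/-- The filtration `W_i = V_i ∩ W` induced on a `g`-submodule `W` of `V`. -/
def restrict (F : ModuleFiltration s V) (W : LieSubmodule K g V) : ModuleFiltration s W where
  sub i :=
    { (F.sub i).toSubmodule.comap W.toSubmodule.subtype with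
      lie_mem := fun {x} _ hm => (F.sub i).lie_mem (x := x) hm }
  antitone i j hij := Submodule.comap_mono (F.antitone i j hij)
  sub_zero := by
    change (F.sub 0).toSubmodule.comap W.toSubmodule.subtype = ⊤
    rw [F.sub_zero, Submodule.comap_top]

/-- The filtration `(V_i + W) / W` induced on the quotient `V / W` by a `g`-submodule `W`. -/
def quotient (F : ModuleFiltration s V) (W : LieSubmodule K g V) :
    ModuleFiltration s (V ⧸ W) where
  sub i :=
    { (F.sub i).toSubmodule.map W.toSubmodule.mkQ with
      lie_mem := by
        rintro x _ ⟨v, hv, rfl⟩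
        exact ⟨⁅x, v⁆, (F.sub i).lie_mem (x := x) hv, rfl⟩ }
  antitone i j hij := Submodule.map_mono (F.antitone i j hij)
  sub_zero := by
    change (F.sub 0).toSubmodule.map W.toSubmodule.mkQ = ⊤
    rw [F.sub_zero, Submodule.map_top, Submodule.range_mkQ]

/-- Equivalence of modules over `(g, s)`: an isomorphism of `g`-modules carrying `V_i` onto `T_i`
for every `i`. -/
def Equivalent (F : ModuleFiltration s V) (G : ModuleFiltration s T) : Prop :=
  ∃ e : V ≃ₗ⁅K, g⁆ T, ∀ i,
    (F.sub i).toSubmodule.map (e.toLinearEquiv : V →ₗ[K] T) = (G.sub i).toSubmodule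

/-- A module over `(g, s)` is irreducible if every `V_i` is an irreducible `g_i`-module. -/
def IsIrreducible (F : ModuleFiltration s V) : Prop :=
  ∀ i, LieModule.IsIrreducible K (s.ideal i) (F.sub i)

/-- For submodules `W' ⊆ W` of `V`, the subfactor `W / W'` with its induced filtration is
equivalent to `T`, for some such `W`, `W'`. -/
def IsSubfactor (F : ModuleFiltration s V) (G : ModuleFiltration s T) : Prop :=
  ∃ W W' : LieSubmodule K g V, W' ≤ W ∧
    ((F.restrict W).quotient (W'.comap W.incl)).Equivalent G

/-- `T` is equivalent to the quotient of `V` by some submodule `Z`, with its induced filtration. -/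
def IsFactor (F : ModuleFiltration s V) (G : ModuleFiltration s T) : Prop :=
  ∃ Z : LieSubmodule K g V, (F.quotient Z).Equivalent G

/-- `T` belongs to the spectrum of `V`: it is an irreducible subfactor of `V`. -/
def MemSpec (F : ModuleFiltration s V) (G : ModuleFiltration s T) : Prop :=
  G.IsIrreducible ∧ F.IsSubfactor G

end ModuleFiltration

end FilteredModule

/-! ### Induced modules -/

section Induced

attribute [local instance] LieRing.ofAssociativeRing

variable {K : Type u} {g : Type v} [Field K] [LieRing g] [LieAlgebra K g]

/-- The map `U(h) → U(g)` of enveloping algebras induced by the inclusion of a subalgebra. -/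
noncomputable def envMap (h : LieSubalgebra K g) :
    UniversalEnvelopingAlgebra K h →ₐ[K] UniversalEnvelopingAlgebra K g :=
  UniversalEnvelopingAlgebra.lift K ((UniversalEnvelopingAlgebra.ι K).comp h.incl)

/-- The image of `U(I)` in `U(g)` for an ideal `I`, that is, the subalgebra of `U(g)` generated
by `I`. -/
noncomputable def envIdeal (I : LieIdeal K g) : Subalgebra K (UniversalEnvelopingAlgebra K g) :=
  Algebra.adjoin K (UniversalEnvelopingAlgebra.ι K '' (I : Set g))

/-- The relations `u a ⊗ w = u ⊗ a w` (`u ∈ U(g)`, `a ∈ U(h)`, `w ∈ W`) that present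
`U(g) ⊗_{U(h)} W` as a quotient of `U(g) ⊗_K W`. -/
noncomputable def indRel (h : LieSubalgebra K g) (W : Type w) [AddCommGroup W] [Module K W]
    [LieRingModule h W] [LieModule K h W] :
    Submodule (UniversalEnvelopingAlgebra K g) (UniversalEnvelopingAlgebra K g ⊗[K] W) :=
  Submodule.span _ {t | ∃ (u : UniversalEnvelopingAlgebra K g)
    (a : UniversalEnvelopingAlgebra K h) (y : W),
    t = (u * envMap h a) ⊗ₜ[K] y -
      u ⊗ₜ[K] (UniversalEnvelopingAlgebra.lift K (LieModule.toEnd K h W) a y)}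

/-- The induced module `ind(W, g) = U(g) ⊗_{U(h)} W`. -/
def Ind (h : LieSubalgebra K g) (W : Type w) [AddCommGroup W] [Module K W]
    [LieRingModule h W] [LieModule K h W] : Type (max u v w) :=
  (UniversalEnvelopingAlgebra K g ⊗[K] W) ⧸ indRel h W

namespace Ind

variable (h : LieSubalgebra K g) (W : Type w) [AddCommGroup W] [Module K W]
    [LieRingModule h W] [LieModule K h W]

noncomputable instance : AddCommGroup (Ind h W) :=
  inferInstanceAs (AddCommGroup ((UniversalEnvelopingAlgebra K g ⊗[K] W) ⧸ indRel h W))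

noncomputable instance : Module (UniversalEnvelopingAlgebra K g) (Ind h W) :=
  inferInstanceAs (Module (UniversalEnvelopingAlgebra K g)
    ((UniversalEnvelopingAlgebra K g ⊗[K] W) ⧸ indRel h W))

noncomputable instance : Module K (Ind h W) :=
  inferInstanceAs (Module K ((UniversalEnvelopingAlgebra K g ⊗[K] W) ⧸ indRel h W))

instance : IsScalarTower K (UniversalEnvelopingAlgebra K g) (Ind h W) :=
  inferInstanceAs (IsScalarTower K (UniversalEnvelopingAlgebra K g)
    ((UniversalEnvelopingAlgebra K g ⊗[K] W) ⧸ indRel h W))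

instance : SMulCommClass K (UniversalEnvelopingAlgebra K g) (Ind h W) :=
  IsScalarTower.to_smulCommClass

variable {W}

/-- The class of `u ⊗ y` in `U(g) ⊗_{U(h)} W`. -/
noncomputable def tmul (u : UniversalEnvelopingAlgebra K g) (y : W) : Ind h W :=
  Submodule.Quotient.mk (p := indRel h W) (u ⊗ₜ[K] y)

theorem smul_tmul (a u : UniversalEnvelopingAlgebra K g) (y : W) :
    a • tmul h u y = tmul h (a * u) y := rfl

variable (W)

noncomputable instance : LieRingModule g (Ind h W) where
  bracket x m := UniversalEnvelopingAlgebra.ι K x • m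
  add_lie x y m := by
    change UniversalEnvelopingAlgebra.ι K (x + y) • m = _
    rw [map_add, add_smul]
  lie_add x m n := smul_add _ _ _
  leibniz_lie x y m := by
    change UniversalEnvelopingAlgebra.ι K x • UniversalEnvelopingAlgebra.ι K y • m =
      UniversalEnvelopingAlgebra.ι K ⁅x, y⁆ • m +
        UniversalEnvelopingAlgebra.ι K y • UniversalEnvelopingAlgebra.ι K x • m
    rw [LieHom.map_lie, LieRing.of_associative_ring_bracket, sub_smul, mul_smul, mul_smul,
      sub_add_cancel]

theorem lie_eq_smul (x : g) (m : Ind h W) : ⁅x, m⁆ = UniversalEnvelopingAlgebra.ι K x • m := rfl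

instance : LieModule K g (Ind h W) where
  smul_lie c x m := by
    rw [lie_eq_smul, lie_eq_smul, map_smul, smul_assoc]
  lie_smul c x m := by
    rw [lie_eq_smul, lie_eq_smul, smul_comm]

end Ind

theorem envIdeal_top : envIdeal (⊤ : LieIdeal K g) = ⊤ := by
  let A := envIdeal (⊤ : LieIdeal K g)
  have hι : ∀ x : g, UniversalEnvelopingAlgebra.ι K x ∈ A := fun x =>
    Algebra.subset_adjoin ⟨x, trivial, rfl⟩
  let f : g →ₗ⁅K⁆ A :=
    { toFun := fun x => ⟨UniversalEnvelopingAlgebra.ι K x, hι x⟩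
      map_add' := fun x y => Subtype.ext (map_add _ x y)
      map_smul' := fun c x => Subtype.ext (map_smul _ c x)
      map_lie' := fun {x y} => Subtype.ext (LieHom.map_lie _ x y) }
  have h : A.val.comp (UniversalEnvelopingAlgebra.lift K f) = AlgHom.id K _ := by
    apply UniversalEnvelopingAlgebra.hom_ext
    ext x
    change A.val (UniversalEnvelopingAlgebra.lift K f (UniversalEnvelopingAlgebra.ι K x)) = _
    rw [UniversalEnvelopingAlgebra.lift_ι_apply]
    rfl
  refine eq_top_iff.mpr fun a _ => ?_
  have := DFunLike.congr_fun h a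
  rw [show a = A.val (UniversalEnvelopingAlgebra.lift K f a) from this.symm]
  exact (UniversalEnvelopingAlgebra.lift K f a).2

/-- The filtration `ind(W₀, g) ⊇ ind(W₁, g₁) ⊇ ⋯ ⊇ ind(W_k, g_k)` of `ind(W, g)`, for a module
`W` over `(h, s)`; here `ind(W_i, g_i) = U(g_i) ⊗_{U(h ∩ g_i)} W_i` is regarded as the subspace of
`U(g) ⊗_{U(h)} W` spanned by the `u ⊗ y` with `u ∈ U(g_i)`, `y ∈ W_i`. -/
noncomputable def ModuleFiltration.ind {k : ℕ} {s : LieFiltration K g k} {h : LieSubalgebra K g}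
    {W : Type w} [AddCommGroup W] [Module K W] [LieRingModule h W] [LieModule K h W]
    (F : ModuleFiltration (s.restrict h) W) : ModuleFiltration s (Ind h W) where
  sub i :=
    { Submodule.span K {m | ∃ u ∈ envIdeal (s.ideal i), ∃ y ∈ F.sub i, m = Ind.tmul h u y} with
      lie_mem := by
        intro x m hm
        change m ∈ Submodule.span K _ at hm
        change UniversalEnvelopingAlgebra.ι K (x : g) • m ∈ Submodule.span K _
        induction hm using Submodule.span_induction with
        | mem m hm =>
          obtain ⟨u, hu, y, hy, rfl⟩ := hm
          refine Submodule.subset_span ⟨UniversalEnvelopingAlgebra.ι K (x : g) * u, ?_, y, hy,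
            Ind.smul_tmul h _ _ _⟩
          exact mul_mem (Algebra.subset_adjoin ⟨x, x.2, rfl⟩) hu
        | zero => rw [smul_zero]; exact zero_mem _
        | add m n _ _ hm hn => rw [smul_add]; exact add_mem hm hn
        | smul c m _ hm => rw [smul_comm]; exact Submodule.smul_mem _ c hm }
  antitone i j hij := by
    refine Submodule.span_mono ?_
    rintro _ ⟨u, hu, y, hy, rfl⟩
    exact ⟨u, Algebra.adjoin_mono (Set.image_mono (s.antitone i j hij)) hu, y,
      F.antitone i j hij hy, rfl⟩
  sub_zero := by
    change Submodule.span K _ = ⊤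
    refine eq_top_iff.mpr fun m _ => ?_
    induction m using Submodule.Quotient.induction_on with
    | H t =>
      induction t using TensorProduct.induction_on with
      | zero => exact zero_mem _
      | tmul u y =>
        refine Submodule.subset_span ⟨u, ?_, y, ?_, rfl⟩
        · rw [s.ideal_zero, envIdeal_top]; trivial
        · change y ∈ (F.sub 0).toSubmodule
          rw [F.sub_zero]; trivial
      | add a b ha hb => exact add_mem (ha trivial) (hb trivial)

end Induced

/-! ### One-dimensional modules -/

section Character

variable {K : Type u} {L : Type v} [Field K] [LieRing L] [LieAlgebra K L]

/-- The one-dimensional `L`-module `K` on which `x ∈ L` acts by the scalar `χ x`. -/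
@[nolint unusedArguments]
def CharModule (_χ : LieAlgebra.LieCharacter K L) : Type u := K

namespace CharModule

variable (χ : LieAlgebra.LieCharacter K L)

instance : AddCommGroup (CharModule χ) := inferInstanceAs (AddCommGroup K)

instance : Module K (CharModule χ) := inferInstanceAs (Module K K)

instance : LieRingModule L (CharModule χ) where
  bracket x m := χ x • m
  add_lie x y m := by
    change χ (x + y) • m = _
    rw [map_add, add_smul]
  lie_add x m n := smul_add _ _ _
  leibniz_lie x y m := by
    change χ x • χ y • m = χ ⁅x, y⁆ • m + χ y • χ x • m
    rw [LieAlgebra.lieCharacter_apply_lie, zero_smul, zero_add, smul_comm]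

theorem lie_eq_smul (x : L) (m : CharModule χ) : ⁅x, m⁆ = χ x • m := rfl

instance : LieModule K L (CharModule χ) where
  smul_lie c x m := by
    rw [lie_eq_smul, lie_eq_smul, map_smul, smul_assoc]
  lie_smul c x m := by
    rw [lie_eq_smul, lie_eq_smul, smul_comm]

/-- The one-dimensional module `V` with the constant filtration `V = V ⊇ ⋯ ⊇ V`. -/
def filtration {k : ℕ} (s : LieFiltration K L k) : ModuleFiltration s (CharModule χ) where
  sub _ := ⊤
  antitone _ _ _ := le_rfl
  sub_zero := rfl

end CharModule

end Character

/-! ### The Vergne polarization and the modules induced from it -/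

namespace LieFiltration

section Vergne

attribute [local instance] LieRing.ofAssociativeRing

variable {K : Type u} {g : Type v} [Field K] [LieRing g] [LieAlgebra K g] {k : ℕ}

/-- The stabilizer `g_i^{f_i} = {x ∈ g_i | f([x, y]) = 0 for all y ∈ g_i}` in `g_i` of the
restriction `f_i` of `f` to `g_i`, as a subspace of `g`. -/
def stab (s : LieFiltration K g k) (f : Module.Dual K g) (i : Fin (k + 1)) : Submodule K g where
  carrier := {x | x ∈ s.ideal i ∧ ∀ y ∈ s.ideal i, f ⁅x, y⁆ = 0}
  add_mem' := by
    rintro a b ⟨ha, ha'⟩ ⟨hb, hb'⟩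
    refine ⟨add_mem ha hb, fun y hy => ?_⟩
    rw [add_lie, map_add, ha' y hy, hb' y hy, add_zero]
  zero_mem' := ⟨zero_mem _, fun y _ => by rw [zero_lie, map_zero]⟩
  smul_mem' := by
    rintro c a ⟨ha, ha'⟩
    refine ⟨Submodule.smul_mem _ c ha, fun y hy => ?_⟩
    rw [smul_lie, map_smul, ha' y hy, smul_zero]

theorem lie_stab (s : LieFiltration K g k) (f : Module.Dual K g) {i j : Fin (k + 1)} (hij : i ≤ j)
    {x y : g} (hx : x ∈ s.stab f i) (hy : y ∈ s.stab f j) :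
    ⁅x, y⁆ ∈ s.stab f j ∧ f ⁅x, y⁆ = 0 := by
  have hle := s.antitone i j hij
  refine ⟨⟨lie_mem_right K g _ x y hy.1, fun z hz => ?_⟩, hx.2 y (hle hy.1)⟩
  rw [lie_lie, map_sub, hx.2 _ (hle (lie_mem_right K g _ y z hz)),
    hy.2 _ (lie_mem_right K g _ x z hz), sub_zero]

theorem lie_iSup_stab (s : LieFiltration K g k) (f : Module.Dual K g) {x y : g}
    (hx : x ∈ ⨆ i, s.stab f i) (hy : y ∈ ⨆ i, s.stab f i) :
    ⁅x, y⁆ ∈ (⨆ i, s.stab f i) ∧ f ⁅x, y⁆ = 0 := by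
  induction hx using Submodule.iSup_induction' with
  | mem i x hx =>
    induction hy using Submodule.iSup_induction' with
    | mem j y hy =>
      rcases le_total i j with hij | hij
      · exact ⟨Submodule.mem_iSup_of_mem j (s.lie_stab f hij hx hy).1,
          (s.lie_stab f hij hx hy).2⟩
      · have := s.lie_stab f hij hy hx
        rw [← lie_skew, map_neg, this.2, neg_zero]
        exact ⟨neg_mem (Submodule.mem_iSup_of_mem i this.1), rfl⟩
    | zero => simp
    | add a b _ _ ha hb =>
      rw [lie_add, map_add, ha.2, hb.2, add_zero]
      exact ⟨add_mem ha.1 hb.1, rfl⟩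
  | zero => simp
  | add a b _ _ ha hb =>
    rw [add_lie, map_add, ha.2, hb.2, add_zero]
    exact ⟨add_mem ha.1 hb.1, rfl⟩

/-- The Vergne polarization `pv(f) = ∑ i, g_i^{f_i}`; it is a subalgebra. -/
def vergne (s : LieFiltration K g k) (f : Module.Dual K g) : LieSubalgebra K g :=
  { (⨆ i, s.stab f i : Submodule K g) with
    lie_mem' := fun hx hy => (s.lie_iSup_stab f hx hy).1 }

/-- The restriction of `f` to its Vergne polarization, a character. -/
def vergneChar (s : LieFiltration K g k) (f : Module.Dual K g) :
    LieAlgebra.LieCharacter K (s.vergne f) :=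
  { f.comp (s.vergne f).toSubmodule.subtype with
    map_lie' := by
      intro x y
      rw [LieRing.of_associative_ring_bracket, mul_comm, sub_self]
      exact (s.lie_iSup_stab f x.2 y.2).2 }

/-- The space of the module `M_s(f) = ind(f|_{pv(f)}, g)`. -/
abbrev M (s : LieFiltration K g k) (f : Module.Dual K g) : Type (max u v) :=
  Ind (s.vergne f) (CharModule (s.vergneChar f))

/-- `M_s(f)` with its filtration `M₀(f₀) ⊇ M₁(f₁) ⊇ ⋯ ⊇ M_k(f_k)`, where
`M_i(f_i) = ind(f_i|_{pv_i(f_i)}, g_i)` and `pv_i(f_i) = pv(f) ∩ g_i`. -/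
noncomputable def filtM (s : LieFiltration K g k) (f : Module.Dual K g) :
    ModuleFiltration s (s.M f) :=
  (CharModule.filtration (s.vergneChar f) (s.restrict (s.vergne f))).ind

/-- The class of `f` in `g*` for the relation: equal Vergne polarizations and equal restrictions
to the common Vergne polarization. -/
def relClass (s : LieFiltration K g k) (f : Module.Dual K g) : Set (Module.Dual K g) :=
  {f' | s.vergne f' = s.vergne f ∧ ∀ x ∈ s.vergne f, f' x = f x}

end Vergne

end LieFiltration

/-- The projection `g* → h*`, restriction of linear forms to a subalgebra. -/
def dualProj {K : Type u} {g : Type v} [Field K] [LieRing g] [LieAlgebra K g]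
    (h : LieSubalgebra K g) (f : Module.Dual K g) : Module.Dual K h :=
  f.comp h.toSubmodule.subtype

/-! Everything reduces to single vectors. If `G` is irreducible, a nonzero `t` in its last term lies
in every term, so it generates the `i`-th term under `g_i` (`IsIrreducible.exists_gen`). The modules
`M_s(f)` and `ind(N_s(η), g)` are likewise generated term by term by `gen` and `indGen`. Hence a
homomorphism matching generators matches filtrations, and by the universal property of induction one
with `indGen ↦ t` exists as soon as `pv(η)` acts on `t` by `η`.

The last term of `ind(N_s(η), g)` is the line through `indGen`, so `pv(η)` acts by `η` on the last
term of each subfactor. An irreducible subfactor therefore receives a homomorphism from the whole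
module and is a factor.

The spectrum criterion needs two facts about a nonzero `t` on which `pv(f)` acts by `f`: an element
of `g` with `t` as an eigenvector lies in `pv(f)` (`mem_vergne_of_lie_eq_smul`), and `t` generates
an irreducible module under each `g_i` (`isSimpleGen`). So `M_s(f)` is in the spectrum if and only
if `pv(η) ⊆ pv(f)` and `f = η` on `pv(η)`. Forms agreeing with `f` on `pv(f)` have the same
polarization (`vergne_eq_of_eqOn`) and are arbitrary off it, which turns this into the condition on
classes.

Irreducibility is proved by descending induction on `i`, jointly with `CobInner`. Let `g_i = g_{i+1}
+ K y`. If `pv(f) ∩ g_i` is not inside `g_{i+1}`, the cyclic module does not grow. Otherwise its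
elements are polynomials in `y` with coefficients in the smaller module, and the operators `p -
f(p)` with `p ∈ pv(f) ∩ g_{i+1}` lower the degree; `CobInner` and characteristic `0` ensure that
some such operator leaves a nonzero leading coefficient.

Over an algebraically closed field, a common generator `t` is a weight vector for the form `f(x) =
l(x t)`, where `l(t) = 1` (`exists_isWeight_of_isSimpleGen`); then `G` is equivalent to `M_s(f)`. -/

namespace LieFiltration

/-! ### Vergne polarizations as maximal isotropic subspaces -/

section Basic

attribute [local instance] LieRing.ofAssociativeRing

variable {K : Type u} {g : Type v} [Field K] [LieRing g] [LieAlgebra K g] {k : ℕ}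

theorem mem_ideal_zero (s : LieFiltration K g k) (x : g) : x ∈ s.ideal 0 := by
  rw [s.ideal_zero]; trivial

theorem eq_zero_of_mem_ideal_last (s : LieFiltration K g k) {x : g}
    (hx : x ∈ s.ideal (Fin.last k)) : x = 0 := by
  rw [s.ideal_last] at hx
  exact hx

theorem ideal_succ_le (s : LieFiltration K g k) (i : Fin k) :
    s.ideal i.succ ≤ s.ideal i.castSucc :=
  s.antitone _ _ (Fin.castSucc_lt_succ).le

theorem exists_sub_smul_mem (s : LieFiltration K g k) (i : Fin k) {x y : g}
    (hx : x ∈ s.ideal i.castSucc) (hx' : x ∉ s.ideal i.succ) (hy : y ∈ s.ideal i.castSucc) :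
    ∃ c : K, y - c • x ∈ s.ideal i.succ := by
  obtain ⟨q, hq⟩ := rank_le_one_iff.mp (s.codim_le i)
  set B := (s.ideal i.succ).toSubmodule.submoduleOf (s.ideal i.castSucc).toSubmodule with hB
  obtain ⟨a, ha⟩ := hq (B.mkQ ⟨x, hx⟩)
  obtain ⟨b, hb⟩ := hq (B.mkQ ⟨y, hy⟩)
  have ha0 : a ≠ 0 := by
    rintro rfl
    rw [zero_smul] at ha
    exact hx' ((Submodule.Quotient.mk_eq_zero B).mp ha.symm)
  refine ⟨b * a⁻¹, ?_⟩
  have key : B.mkQ (⟨y, hy⟩ - (b * a⁻¹) • ⟨x, hx⟩) = 0 := by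
    rw [map_sub, map_smul, ← ha, ← hb, smul_smul, mul_assoc, inv_mul_cancel₀ ha0, mul_one, sub_self]
  exact (Submodule.Quotient.mk_eq_zero B).mp key

theorem fg_ideal (s : LieFiltration K g k) (i : Fin (k + 1)) : (s.ideal i).toSubmodule.FG := by
  induction i using Fin.reverseInduction with
  | last => rw [s.ideal_last]; exact Submodule.fg_bot
  | cast i ih =>
    by_cases hle : s.ideal i.castSucc ≤ s.ideal i.succ
    · rwa [le_antisymm hle (s.ideal_succ_le i)]
    · obtain ⟨x, hx, hx'⟩ := Set.not_subset.mp hle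
      have : (s.ideal i.castSucc).toSubmodule = (s.ideal i.succ).toSubmodule ⊔ K ∙ x := by
        apply le_antisymm
        · intro y hy
          obtain ⟨c, hc⟩ := s.exists_sub_smul_mem i hx hx' hy
          rw [← sub_add_cancel y (c • x)]
          exact Submodule.add_mem_sup hc
            (Submodule.smul_mem _ _ (Submodule.mem_span_singleton_self x))
        · refine sup_le (s.ideal_succ_le i) ?_
          rw [Submodule.span_singleton_le_iff_mem]
          exact hx
      rw [this]
      exact ih.sup (Submodule.fg_span_singleton x)

/-- On the finite-dimensional space `g_i`, a functional vanishing on the radical of the form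
`f([·,·])` is represented by a vector; this is applied to `f([y,·])`. -/
theorem exists_lie_sub_eq_zero (s : LieFiltration K g k) (f : Module.Dual K g) (i : Fin (k + 1))
    {y : g} (hy : ∀ p ∈ s.stab f i, f ⁅y, p⁆ = 0) :
    ∃ z ∈ s.ideal i, ∀ t ∈ s.ideal i, f ⁅y - z, t⁆ = 0 := by
  set I := (s.ideal i).toSubmodule with hI
  have : Module.Finite K I := Module.Finite.iff_fg.mpr (s.fg_ideal i)
  let β : g →ₗ[K] g →ₗ[K] K := (LieModule.toEnd K g g).toLinearMap.compr₂ f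
  have hβ : ∀ a b, β a b = f ⁅a, b⁆ := fun _ _ => rfl
  let B : I →ₗ[K] Module.Dual K I := β.domRestrict₁₂ I I
  let φ : Module.Dual K I := (β y).comp I.subtype
  have hφ : φ ∈ (LinearMap.ker B).dualAnnihilator := by
    rw [Submodule.mem_dualAnnihilator]
    intro p hp
    refine hy p ⟨p.2, fun t ht => ?_⟩
    exact DFunLike.congr_fun (LinearMap.mem_ker.mp hp) (⟨t, ht⟩ : I)
  rw [← LinearMap.range_dualMap_eq_dualAnnihilator_ker] at hφ
  obtain ⟨ψ, hψ⟩ := hφ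
  obtain ⟨z, rfl⟩ := (Module.evalEquiv K I).surjective ψ
  refine ⟨-z, neg_mem z.2, fun t ht => ?_⟩
  have := DFunLike.congr_fun hψ (⟨t, ht⟩ : I)
  have h1 : f ⁅t, (z : g)⁆ = f ⁅y, t⁆ := this
  rw [sub_neg_eq_add, add_lie, map_add, ← h1, ← lie_skew, map_neg, neg_add_cancel]

theorem stab_le_vergne (s : LieFiltration K g k) (f : Module.Dual K g) {i : Fin (k + 1)} {x : g}
    (hx : x ∈ s.stab f i) : x ∈ s.vergne f :=
  Submodule.mem_iSup_of_mem (p := s.stab f) i hx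

theorem lie_vergne (s : LieFiltration K g k) (f : Module.Dual K g) {x y : g}
    (hx : x ∈ s.vergne f) (hy : y ∈ s.vergne f) : f ⁅x, y⁆ = 0 :=
  (s.lie_iSup_stab f hx hy).2

/-- Split `y = (y - z) + z` with `z ∈ g_{i+1}` and `y - z` orthogonal to `g_{i+1}`. Then `z` is
covered by the inductive hypothesis, while `y - z` is orthogonal to `g_{i+1}` and to itself, hence
to all of `g_i`. -/
theorem mem_vergne_of_lie_succ_aux (s : LieFiltration K g k) (f : Module.Dual K g) (i : Fin k)
    (ih : ∀ y ∈ s.ideal i.succ, (∀ p ∈ s.vergne f, p ∈ s.ideal i.succ → f ⁅y, p⁆ = 0) →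
      y ∈ s.vergne f)
    {y : g} (hy : y ∈ s.ideal i.castSucc)
    (hyp : ∀ p ∈ s.vergne f, p ∈ s.ideal i.succ → f ⁅y, p⁆ = 0) : y ∈ s.vergne f := by
  by_cases hyi : y ∈ s.ideal i.succ
  · exact ih y hyi hyp
  · obtain ⟨z, hz, hzt⟩ := s.exists_lie_sub_eq_zero f i.succ (y := y)
      fun p hp => hyp p (s.stab_le_vergne f hp) hp.1
    have hzP : z ∈ s.vergne f := ih z hz fun p hp hpi => by
      have := hzt p hpi
      rwa [sub_lie, map_sub, hyp p hp hpi, zero_sub, neg_eq_zero] at this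
    have hst : y - z ∈ s.stab f i.castSucc := by
      have hyz : y - z ∈ s.ideal i.castSucc := sub_mem hy (s.ideal_succ_le i hz)
      refine ⟨hyz, fun t ht => ?_⟩
      obtain ⟨c, hc⟩ := s.exists_sub_smul_mem i hyz
        (fun h => hyi (by simpa using add_mem h hz)) ht
      have := hzt _ hc
      rwa [lie_sub, lie_smul, lie_self, smul_zero, sub_zero] at this
    simpa using add_mem (s.stab_le_vergne f hst) hzP

/-- The intersection `pv(f) ∩ g_i` is maximal isotropic in `g_i`. -/
theorem mem_vergne_of_lie (s : LieFiltration K g k) (f : Module.Dual K g) (i : Fin (k + 1)) :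
    ∀ y ∈ s.ideal i, (∀ p ∈ s.vergne f, p ∈ s.ideal i → f ⁅y, p⁆ = 0) → y ∈ s.vergne f := by
  induction i using Fin.reverseInduction with
  | last =>
    intro y hy _
    rw [s.eq_zero_of_mem_ideal_last hy]
    exact zero_mem _
  | cast i ih =>
    exact fun y hy hyp => s.mem_vergne_of_lie_succ_aux f i ih hy
      fun p hp hpi => hyp p hp (s.ideal_succ_le i hpi)

/-- An element of `g_i` that is orthogonal to `pv(f) ∩ g_{i+1}` belongs to `pv(f)`. -/
theorem mem_vergne_of_lie_succ (s : LieFiltration K g k) (f : Module.Dual K g) (i : Fin k)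
    {y : g} (hy : y ∈ s.ideal i.castSucc)
    (hyp : ∀ p ∈ s.vergne f, p ∈ s.ideal i.succ → f ⁅y, p⁆ = 0) : y ∈ s.vergne f :=
  s.mem_vergne_of_lie_succ_aux f i (s.mem_vergne_of_lie f i.succ) hy hyp

/-- Maximal isotropy tests `x ∈ g_i` only against `p ∈ pv ∩ g_{i+1}`. The bracket `[x, p]` lies in
`g_{i+1}`, where the two polarizations agree by induction, so both forms take the same value on it.
-/
theorem vergne_eq_of_eqOn (s : LieFiltration K g k) {f f' : Module.Dual K g}
    (h : ∀ x ∈ s.vergne f, f' x = f x) : s.vergne f' = s.vergne f := by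
  have key : ∀ i, ∀ x ∈ s.ideal i, x ∈ s.vergne f' ↔ x ∈ s.vergne f := by
    intro i
    induction i using Fin.reverseInduction with
    | last =>
      intro x hx
      rw [s.eq_zero_of_mem_ideal_last hx]
      simp only [zero_mem]
    | cast i ih =>
      intro x hx
      constructor
      · intro hxP
        refine s.mem_vergne_of_lie_succ f i hx fun p hp hpi => ?_
        have hxp := lie_mem_right K g _ x p hpi
        have hp' := (ih p hpi).mpr hp
        rw [← h _ ((ih _ hxp).mp (LieSubalgebra.lie_mem _ hxP hp')), s.lie_vergne f' hxP hp']
      · intro hxP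
        refine s.mem_vergne_of_lie_succ f' i hx fun p hp hpi => ?_
        have hp' := (ih p hpi).mp hp
        rw [h _ (LieSubalgebra.lie_mem _ hxP hp'), s.lie_vergne f hxP hp']
  ext x
  exact key 0 x (s.mem_ideal_zero x)

end Basic

end LieFiltration

/-! ### Cyclic subspaces and the filtration by degree in one element -/

section Cyc

variable {K : Type u} {g : Type v} [Field K] [LieRing g] [LieAlgebra K g]
variable {T : Type w} [AddCommGroup T] [Module K T] [LieRingModule g T]

/-- The smallest subspace of a `g`-module that contains `e` and is stable under the ideal `I`. -/
def cyc (I : LieIdeal K g) (e : T) : Submodule K T :=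
  sInf {W | e ∈ W ∧ ∀ x ∈ I, ∀ m ∈ W, ⁅x, m⁆ ∈ W}

theorem mem_cyc_self (I : LieIdeal K g) (e : T) : e ∈ cyc I e := by
  rw [cyc, Submodule.mem_sInf]
  exact fun W hW => hW.1

theorem lie_mem_cyc {I : LieIdeal K g} {e m : T} {x : g} (hx : x ∈ I) (hm : m ∈ cyc I e) :
    ⁅x, m⁆ ∈ cyc I e := by
  rw [cyc, Submodule.mem_sInf] at *
  exact fun W hW => hW.2 x hx m (hm W hW)

theorem cyc_le {I : LieIdeal K g} {e : T} {W : Submodule K T} (he : e ∈ W)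
    (hW : ∀ x ∈ I, ∀ m ∈ W, ⁅x, m⁆ ∈ W) : cyc I e ≤ W :=
  sInf_le ⟨he, hW⟩

theorem cyc_le_cyc {I : LieIdeal K g} {e m : T} (hm : m ∈ cyc I e) : cyc I m ≤ cyc I e :=
  cyc_le hm fun _ hx _ hm => lie_mem_cyc hx hm

theorem cyc_mono {I J : LieIdeal K g} (hIJ : I ≤ J) (e : T) : cyc I e ≤ cyc J e :=
  cyc_le (mem_cyc_self J e) fun _ hx _ hm => lie_mem_cyc (hIJ hx) hm

theorem cyc_zero (I : LieIdeal K g) : cyc I (0 : T) = ⊥ :=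
  le_bot_iff.mp (cyc_le (Submodule.zero_mem _) fun x _ m hm => by
    rw [Submodule.mem_bot] at hm ⊢; rw [hm, lie_zero])

variable [LieModule K g T]

/-- The sum of the subspaces `y ^ j M` for `j < n`. -/
def adFiltr (y : g) (M : Submodule K T) : ℕ → Submodule K T
  | 0 => ⊥
  | n + 1 => adFiltr y M n ⊔ M.map ((LieModule.toEnd K g T y : Module.End K T) ^ n)

variable {y : g} {M : Submodule K T}

theorem mem_adFiltr_succ {n : ℕ} {e : T} :
    e ∈ adFiltr y M (n + 1) ↔
      ∃ d ∈ adFiltr y M n, ∃ m ∈ M, e = (LieModule.toEnd K g T y ^ n : Module.End K T) m + d := by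
  rw [adFiltr, Submodule.mem_sup]
  constructor
  · rintro ⟨d, hd, _, ⟨m, hm, rfl⟩, rfl⟩
    exact ⟨d, hd, m, hm, add_comm _ _⟩
  · rintro ⟨d, hd, m, hm, rfl⟩
    exact ⟨d, hd, _, ⟨m, hm, rfl⟩, add_comm _ _⟩

theorem adFiltr_le_succ (n : ℕ) : adFiltr y M n ≤ adFiltr y M (n + 1) := le_sup_left

theorem adFiltr_mono : Monotone (adFiltr y M) := monotone_nat_of_le_succ adFiltr_le_succ

theorem pow_mem_adFiltr (n : ℕ) {m : T} (hm : m ∈ M) :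
    (LieModule.toEnd K g T y ^ n : Module.End K T) m ∈ adFiltr y M (n + 1) :=
  mem_adFiltr_succ.mpr ⟨0, zero_mem _, m, hm, (add_zero _).symm⟩

theorem toEnd_pow_succ_apply (n : ℕ) (m : T) :
    (LieModule.toEnd K g T y ^ (n + 1) : Module.End K T) m =
      ⁅y, (LieModule.toEnd K g T y ^ n : Module.End K T) m⁆ := by
  rw [pow_succ', Module.End.mul_apply, LieModule.toEnd_apply_apply]

theorem lie_self_mem_adFiltr {n : ℕ} {d : T} (hd : d ∈ adFiltr y M n) :
    ⁅y, d⁆ ∈ adFiltr y M (n + 1) := by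
  induction n generalizing d with
  | zero =>
    rw [adFiltr, Submodule.mem_bot] at hd
    rw [hd, lie_zero]
    exact zero_mem _
  | succ n ih =>
    obtain ⟨d', hd', m, hm, rfl⟩ := mem_adFiltr_succ.mp hd
    rw [lie_add, ← toEnd_pow_succ_apply]
    exact add_mem (pow_mem_adFiltr _ hm) (adFiltr_le_succ _ (ih hd'))

section Stable

variable {J : LieIdeal K g}

theorem lie_pow_sub_mem (hM : ∀ x ∈ J, ∀ m ∈ M, ⁅x, m⁆ ∈ M) (n : ℕ)
    {x : g} (hx : x ∈ J) {m : T} (hm : m ∈ M) :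
    ⁅x, (LieModule.toEnd K g T y ^ n : Module.End K T) m⁆ -
      (LieModule.toEnd K g T y ^ n : Module.End K T) ⁅x, m⁆ ∈ adFiltr y M n := by
  induction n generalizing x with
  | zero => simp
  | succ n ih =>
    have hxy : ⁅x, y⁆ ∈ J := lie_mem_left K g J x y hx
    have h1 := lie_self_mem_adFiltr (ih hx)
    have h2 := add_mem (adFiltr_le_succ _ (ih hxy)) (pow_mem_adFiltr (y := y) n (hM _ hxy m hm))
    rw [sub_add_cancel] at h2
    rw [toEnd_pow_succ_apply, toEnd_pow_succ_apply, leibniz_lie]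
    rw [lie_sub] at h1
    convert add_mem h1 h2 using 1
    abel

theorem lie_mem_adFiltr (hM : ∀ x ∈ J, ∀ m ∈ M, ⁅x, m⁆ ∈ M) {n : ℕ}
    {x : g} (hx : x ∈ J) {d : T} (hd : d ∈ adFiltr y M n) :
    ⁅x, d⁆ ∈ adFiltr y M n := by
  induction n generalizing d with
  | zero =>
    rw [adFiltr, Submodule.mem_bot] at hd
    rw [hd, lie_zero]
    exact zero_mem _
  | succ n ih =>
    obtain ⟨d', hd', m, hm, rfl⟩ := mem_adFiltr_succ.mp hd
    have h1 := add_mem (adFiltr_le_succ _ (lie_pow_sub_mem hM n hx hm))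
      (pow_mem_adFiltr (y := y) n (hM _ hx m hm))
    rw [sub_add_cancel] at h1
    rw [lie_add]
    exact add_mem h1 (adFiltr_le_succ _ (ih hd'))

/-- The first two terms of commuting `x` past `y ^ (n + 1)`. The factor `n + 1` is the source of the
restriction on the characteristic. -/
theorem lie_pow_succ_sub_mem (hM : ∀ x ∈ J, ∀ m ∈ M, ⁅x, m⁆ ∈ M) (n : ℕ)
    {x : g} (hx : x ∈ J) {m : T} (hm : m ∈ M) :
    ⁅x, (LieModule.toEnd K g T y ^ (n + 1) : Module.End K T) m⁆ -
      (LieModule.toEnd K g T y ^ (n + 1) : Module.End K T) ⁅x, m⁆ -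
      ((n : K) + 1) • (LieModule.toEnd K g T y ^ n : Module.End K T) ⁅⁅x, y⁆, m⁆ ∈
        adFiltr y M n := by
  induction n with
  | zero =>
    simp
  | succ n ih =>
    have hxy : ⁅x, y⁆ ∈ J := lie_mem_left K g J x y hx
    have h1 := lie_self_mem_adFiltr ih
    have h2 := lie_pow_sub_mem (y := y) hM (n + 1) hxy hm
    rw [toEnd_pow_succ_apply (n + 1) m, leibniz_lie]
    rw [lie_sub, lie_sub, lie_smul, ← toEnd_pow_succ_apply, ← toEnd_pow_succ_apply] at h1
    convert add_mem h1 h2 using 1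
    push_cast
    module

/-- If `W` is stable under `J` and contains `y ^ n q` up to lower terms, then the same holds for
every element of `cyc J q`. -/
theorem exists_pow_add_mem (hM : ∀ x ∈ J, ∀ m ∈ M, ⁅x, m⁆ ∈ M) {n : ℕ}
    {W : Submodule K T} (hW : ∀ x ∈ J, ∀ m ∈ W, ⁅x, m⁆ ∈ W)
    {q d : T} (hq : q ∈ M) (hd : d ∈ adFiltr y M n)
    (hqd : (LieModule.toEnd K g T y ^ n : Module.End K T) q + d ∈ W) {m : T} (hm : m ∈ cyc J q) :
    ∃ d ∈ adFiltr y M n, (LieModule.toEnd K g T y ^ n : Module.End K T) m + d ∈ W := by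
  let S : Submodule K T :=
    { carrier := {m | m ∈ M ∧ ∃ d ∈ adFiltr y M n,
        (LieModule.toEnd K g T y ^ n : Module.End K T) m + d ∈ W}
      zero_mem' := ⟨zero_mem _, 0, zero_mem _, by simp⟩
      add_mem' := by
        rintro a b ⟨ha, d, hd, had⟩ ⟨hb, d', hd', hbd⟩
        refine ⟨add_mem ha hb, d + d', add_mem hd hd', ?_⟩
        rw [map_add, add_add_add_comm]
        exact add_mem had hbd
      smul_mem' := by
        rintro c a ⟨ha, d, hd, had⟩
        refine ⟨Submodule.smul_mem _ c ha, c • d, Submodule.smul_mem _ c hd, ?_⟩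
        rw [map_smul, ← smul_add]
        exact Submodule.smul_mem _ c had }
  -- `J` commutes with `y ^ n` up to lower degree, so the admissible leading coefficients form a
  -- `J`-stable subspace.
  have hS : cyc J q ≤ S := by
    refine cyc_le ⟨hq, d, hd, hqd⟩ ?_
    rintro x hx a ⟨ha, d, hd, had⟩
    refine ⟨hM x hx a ha, _, add_mem (lie_pow_sub_mem (y := y) hM n hx ha)
      (lie_mem_adFiltr hM hx hd), ?_⟩
    convert hW x hx _ had using 1
    rw [lie_add]
    abel
  exact (hS hm).2

end Stable

end Cyc

/-! ### Weight vectors generate irreducible modules -/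

namespace LieFiltration

section Weight

variable {K : Type u} {g : Type v} [Field K] [LieRing g] [LieAlgebra K g] {k : ℕ}
variable {T : Type w} [AddCommGroup T] [Module K T] [LieRingModule g T]

/-- The elements of `pv(f) ∩ I` act on `w` by the scalars given by `f`. -/
def IsWeight (s : LieFiltration K g k) (f : Module.Dual K g) (I : LieIdeal K g) (w : T) : Prop :=
  ∀ p ∈ s.vergne f, p ∈ I → ⁅p, w⁆ = f p • w

theorem IsWeight.mono {s : LieFiltration K g k} {f : Module.Dual K g} {I J : LieIdeal K g} {w : T}
    (hw : s.IsWeight f J w) (hIJ : I ≤ J) : s.IsWeight f I w :=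
  fun p hp hpI => hw p hp (hIJ hpI)

variable [LieModule K g T]

/-- For `p ∈ pv(f) ∩ g_{i+1}`, both `y` and `p` act on `w` by scalars, so `[y, p]` kills `w`. By
induction `[y, p] ∈ pv(f)`, whence `f([y, p]) = 0`, and maximal isotropy applies. -/
theorem mem_vergne_of_lie_eq_smul (s : LieFiltration K g k) (f : Module.Dual K g)
    {w : T} (hw0 : w ≠ 0) (i : Fin (k + 1)) (hw : s.IsWeight f (s.ideal i) w) :
    ∀ y ∈ s.ideal i, ∀ c : K, ⁅y, w⁆ = c • w → y ∈ s.vergne f := by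
  induction i using Fin.reverseInduction with
  | last =>
    intro y hy _ _
    rw [s.eq_zero_of_mem_ideal_last hy]
    exact zero_mem _
  | cast i ih =>
    intro y hy c hc
    have hw' := hw.mono (s.ideal_succ_le i)
    refine s.mem_vergne_of_lie_succ f i hy fun p hp hpi => ?_
    have h0 : ⁅⁅y, p⁆, w⁆ = 0 := by
      rw [lie_lie, hc, hw' p hp hpi, lie_smul, lie_smul, hc, hw' p hp hpi, smul_comm, sub_self]
    have hyp := lie_mem_right K g _ y p hpi
    have hmem := ih hw' _ hyp 0 (by rw [h0, zero_smul])
    have := hw' _ hmem hyp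
    rw [h0] at this
    exact (smul_eq_zero.mp this.symm).resolve_right hw0

/-- Every nonzero element of `cyc I w` generates `w` under `I`. -/
def IsSimpleGen (I : LieIdeal K g) (w : T) : Prop :=
  ∀ e ∈ cyc I w, e ≠ 0 → w ∈ cyc I e

/-- The cocycles `p ↦ [x, p] w` of `pv(f) ∩ I` that are coboundaries of elements of `cyc I w` are
obtained from the derivations `ad z` with `z ∈ I`. -/
def CobInner (s : LieFiltration K g k) (f : Module.Dual K g) (I : LieIdeal K g) (w : T) : Prop :=
  ∀ m ∈ cyc I w, ∀ x : g, (∀ p ∈ s.vergne f, p ∈ I → ⁅p, m⁆ - f p • m = ⁅⁅x, p⁆, w⁆) →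
    ∃ z ∈ I, ∃ c : K, m + ⁅z, w⁆ = c • w

theorem lie_lie_eq_of_add_eq_smul {s : LieFiltration K g k} {f : Module.Dual K g}
    {I : LieIdeal K g} {w m : T} (hw : s.IsWeight f I w) {z : g} {c : K}
    (h : m + ⁅z, w⁆ = c • w) {p : g} (hp : p ∈ s.vergne f) (hpI : p ∈ I) :
    ⁅⁅z, p⁆, w⁆ = ⁅p, m⁆ - f p • m := by
  have hz : ⁅z, w⁆ = c • w - m := eq_sub_of_add_eq' h
  rw [lie_lie, hw p hp hpI, lie_smul, hz, lie_sub, lie_smul, hw p hp hpI]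
  module

/-- A weight vector solves the cocycle equation with `x = 0`. The resulting `z` satisfies `f([z, p])
= 0` for all `p ∈ pv(f) ∩ g_i`, so it lies in `pv(f)` and acts on `w` by a scalar. -/
theorem CobInner.exists_eq_smul {s : LieFiltration K g k} {f : Module.Dual K g}
    {i : Fin (k + 1)} {w : T} (hE : s.CobInner f (s.ideal i) w) (hw0 : w ≠ 0)
    (hw : s.IsWeight f (s.ideal i) w) {m : T} (hm : m ∈ cyc (s.ideal i) w)
    (hmw : s.IsWeight f (s.ideal i) m) : ∃ c : K, m = c • w := by
  obtain ⟨z, hz, c, hc⟩ := hE m hm 0 fun p hp hpI => by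
    rw [hmw p hp hpI, sub_self, zero_lie, zero_lie]
  have hzP : z ∈ s.vergne f := by
    refine s.mem_vergne_of_lie f i z hz fun p hp hpI => ?_
    have h0 : ⁅⁅z, p⁆, w⁆ = 0 := by
      rw [lie_lie_eq_of_add_eq_smul hw hc hp hpI, hmw p hp hpI, sub_self]
    have hzp := lie_mem_right K g _ z p hpI
    have hmem := s.mem_vergne_of_lie_eq_smul f hw0 i hw _ hzp 0 (by rw [h0, zero_smul])
    have := hw _ hmem hzp
    rw [h0] at this
    exact (smul_eq_zero.mp this.symm).resolve_right hw0
  refine ⟨c - f z, ?_⟩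
  rw [hw z hzP hz] at hc
  rw [sub_smul, ← hc, add_sub_cancel_right]

section Step

variable {s : LieFiltration K g k} {f : Module.Dual K g} {i : Fin k} {w : T}

/-- A solution would give `z ∈ g_{i+1}` with `y - z` orthogonal to `pv(f) ∩ g_{i+1}`. Then `y - z ∈
pv(f) ∩ g_i ⊆ g_{i+1}`, contradicting the choice of `y`. -/
theorem not_forall_lie_sub_eq (hE : s.CobInner f (s.ideal i.succ) w) (hw0 : w ≠ 0)
    (hw : s.IsWeight f (s.ideal i.succ) w)
    (hP : ∀ p ∈ s.vergne f, p ∈ s.ideal i.castSucc → p ∈ s.ideal i.succ)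
    {y : g} (hy : y ∈ s.ideal i.castSucc) (hy' : y ∉ s.ideal i.succ) {m : T}
    (hm : m ∈ cyc (s.ideal i.succ) w) :
    ¬ ∀ p ∈ s.vergne f, p ∈ s.ideal i.succ → ⁅p, m⁆ - f p • m = ⁅⁅y, p⁆, w⁆ := by
  intro h
  obtain ⟨z, hz, c, hc⟩ := hE m hm y h
  have hyz : y - z ∈ s.ideal i.castSucc := sub_mem hy (s.ideal_succ_le i hz)
  have hyzP : y - z ∈ s.vergne f := by
    refine s.mem_vergne_of_lie_succ f i hyz fun p hp hpI => ?_
    have h0 : ⁅⁅y - z, p⁆, w⁆ = 0 := by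
      rw [sub_lie, sub_lie, lie_lie_eq_of_add_eq_smul hw hc hp hpI, h p hp hpI, sub_self]
    have hzp := lie_mem_right K g _ (y - z) p hpI
    have hmem := s.mem_vergne_of_lie_eq_smul f hw0 _ hw _ hzp 0 (by rw [h0, zero_smul])
    have := hw _ hmem hzp
    rw [h0] at this
    exact (smul_eq_zero.mp this.symm).resolve_right hw0
  exact hy' (by simpa using add_mem (hP _ hyzP hyz) hz)

/-- Computes the degree `n` coefficient of `(p - f(p)) e`; the terms of degree `n + 1` cancel
because `w` is a weight vector. -/
theorem exists_smul_sub_pow_mem {y : g} (hw : s.IsWeight f (s.ideal i.succ) w)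
    {p : g} (hp : p ∈ s.vergne f) (hpI : p ∈ s.ideal i.succ) {M : Submodule K T}
    (hM : ∀ x ∈ s.ideal i.succ, ∀ m ∈ M, ⁅x, m⁆ ∈ M) (hwM : w ∈ M) {n : ℕ} {m d : T} (c : K)
    (hm : m ∈ M) (hd : d ∈ adFiltr y M n) :
    letI e := (LieModule.toEnd K g T y ^ (n + 1) : Module.End K T) (c • w) +
      ((LieModule.toEnd K g T y ^ n : Module.End K T) m + d)
    ⁅p, e⁆ - f p • e - (LieModule.toEnd K g T y ^ n : Module.End K T)
      ((c * ((n : K) + 1)) • ⁅⁅p, y⁆, w⁆ + (⁅p, m⁆ - f p • m)) ∈ adFiltr y M n := by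
  have h1 := lie_pow_succ_sub_mem (y := y) hM n hpI (Submodule.smul_mem M c hwM)
  have h2 := lie_pow_sub_mem (y := y) hM n hpI hm
  have h3 := lie_mem_adFiltr hM hpI hd
  have h4 := Submodule.smul_mem _ (f p) hd
  convert sub_mem (add_mem (add_mem h1 h2) h3) h4 using 1
  simp only [lie_add, lie_smul, map_smul, map_add, map_sub, hw p hp hpI, smul_add]
  module

theorem cyc_castSucc_eq {x : g} (hx : x ∈ s.ideal i.castSucc) (hx' : x ∉ s.ideal i.succ) {c : K}
    (hxw : ⁅x, w⁆ = c • w) : cyc (s.ideal i.castSucc) w = cyc (s.ideal i.succ) w := by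
  refine le_antisymm (cyc_le (mem_cyc_self _ _) ?_) (cyc_mono (s.ideal_succ_le i) w)
  have hstable : ∀ m ∈ cyc (s.ideal i.succ) w, ⁅x, m⁆ ∈ cyc (s.ideal i.succ) w := by
    have : cyc (s.ideal i.succ) w ≤ cyc (s.ideal i.succ) w ⊓
        (cyc (s.ideal i.succ) w).comap (LieModule.toEnd K g T x) := by
      refine cyc_le ⟨mem_cyc_self _ _, ?_⟩ ?_
      · change ⁅x, w⁆ ∈ cyc (s.ideal i.succ) w
        rw [hxw]
        exact Submodule.smul_mem _ _ (mem_cyc_self _ _)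
      · rintro z hz m ⟨hm, hm'⟩
        refine ⟨lie_mem_cyc hz hm, ?_⟩
        change ⁅x, ⁅z, m⁆⁆ ∈ cyc (s.ideal i.succ) w
        rw [leibniz_lie]
        exact add_mem (lie_mem_cyc (lie_mem_right K g _ x z hz) hm) (lie_mem_cyc hz hm')
    exact fun m hm => (this hm).2
  intro z hz m hm
  obtain ⟨a, ha⟩ := s.exists_sub_smul_mem i hx hx' hz
  rw [← sub_add_cancel z (a • x), add_lie, smul_lie]
  exact add_mem (lie_mem_cyc ha hm) (Submodule.smul_mem _ _ (hstable m hm))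

theorem exists_mem_adFiltr {y : g} (hy : y ∈ s.ideal i.castSucc) (hy' : y ∉ s.ideal i.succ) {e : T}
    (he : e ∈ cyc (s.ideal i.castSucc) w) :
    ∃ n, e ∈ adFiltr y (cyc (s.ideal i.succ) w) n := by
  have hle : cyc (s.ideal i.castSucc) w ≤ ⨆ n, adFiltr y (cyc (s.ideal i.succ) w) n := by
    refine cyc_le (Submodule.mem_iSup_of_mem 1 (pow_mem_adFiltr 0 (mem_cyc_self _ _))) ?_
    intro x hx m hm
    obtain ⟨n, hn⟩ := (Submodule.mem_iSup_of_directed _ adFiltr_mono.directed_le).mp hm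
    obtain ⟨c, hc⟩ := s.exists_sub_smul_mem i hy hy' hx
    refine Submodule.mem_iSup_of_mem (n + 1) ?_
    rw [← sub_add_cancel x (c • y), add_lie, smul_lie]
    exact add_mem (adFiltr_le_succ _ (lie_mem_adFiltr (fun x hx m hm => lie_mem_cyc hx hm) hc hn))
      (Submodule.smul_mem _ _ (lie_self_mem_adFiltr hn))
  exact (Submodule.mem_iSup_of_directed _ adFiltr_mono.directed_le).mp (hle he)

variable [CharZero K]

section Split

variable {y : g}

/-- Descent on the degree: some `p - f(p)` produces a nonzero coefficient one degree lower, which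
simplicity over `g_{i+1}` turns back into `w`. -/
theorem mem_cyc_pow_add (hS : IsSimpleGen (s.ideal i.succ) w)
    (hE : s.CobInner f (s.ideal i.succ) w) (hw0 : w ≠ 0)
    (hw : s.IsWeight f (s.ideal i.succ) w)
    (hP : ∀ p ∈ s.vergne f, p ∈ s.ideal i.castSucc → p ∈ s.ideal i.succ)
    (hy : y ∈ s.ideal i.castSucc) (hy' : y ∉ s.ideal i.succ) (n : ℕ) {d : T}
    (hd : d ∈ adFiltr y (cyc (s.ideal i.succ) w) n) :
    w ∈ cyc (s.ideal i.castSucc) ((LieModule.toEnd K g T y ^ n : Module.End K T) w + d) := by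
  have hM : ∀ x ∈ s.ideal i.succ, ∀ m ∈ cyc (s.ideal i.succ) w, ⁅x, m⁆ ∈ cyc (s.ideal i.succ) w :=
    fun x hx m hm => lie_mem_cyc hx hm
  have hwM := mem_cyc_self (s.ideal i.succ) w
  induction n generalizing d with
  | zero =>
    rw [adFiltr, Submodule.mem_bot] at hd
    rw [hd, add_zero, pow_zero]
    exact mem_cyc_self _ _
  | succ n ih =>
    obtain ⟨d', hd', m, hm, rfl⟩ := mem_adFiltr_succ.mp hd
    set e := (LieModule.toEnd K g T y ^ (n + 1) : Module.End K T) w +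
      ((LieModule.toEnd K g T y ^ n : Module.End K T) m + d') with he
    obtain ⟨p, hp, hpI, hq⟩ : ∃ p ∈ s.vergne f, p ∈ s.ideal i.succ ∧
        ((1 : K) * ((n : K) + 1)) • ⁅⁅p, y⁆, w⁆ + (⁅p, m⁆ - f p • m) ≠ 0 := by
      -- If all these coefficients vanished, `(n + 1)⁻¹ m` would solve the equation excluded by
      -- `not_forall_lie_sub_eq`.
      by_contra! hcon
      refine not_forall_lie_sub_eq hE hw0 hw hP hy hy'
        (Submodule.smul_mem _ ((n : K) + 1)⁻¹ hm) fun p hp hpI => ?_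
      have h := eq_neg_of_add_eq_zero_right (hcon p hp hpI)
      rw [lie_smul, smul_comm, ← smul_sub, h, ← smul_neg, smul_smul, one_mul,
        inv_mul_cancel₀ (Nat.cast_add_one_ne_zero n), one_smul, ← neg_lie, lie_skew]
    have hpy : ⁅p, y⁆ ∈ s.ideal i.succ := lie_mem_left K g _ p y hpI
    have hqM : ((1 : K) * ((n : K) + 1)) • ⁅⁅p, y⁆, w⁆ + (⁅p, m⁆ - f p • m) ∈
        cyc (s.ideal i.succ) w :=
      add_mem (Submodule.smul_mem _ _ (hM _ hpy _ hwM))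
        (sub_mem (hM _ hpI _ hm) (Submodule.smul_mem _ _ hm))
    have hkey := exists_smul_sub_pow_mem (y := y) hw hp hpI hM hwM 1 hm hd'
    rw [one_smul] at hkey
    obtain ⟨d'', hd'', hmem⟩ := exists_pow_add_mem hM
      (W := cyc (s.ideal i.castSucc) e)
      (fun x hx m hm => lie_mem_cyc (s.ideal_succ_le i hx) hm) hqM hkey
      (by
        rw [add_sub_cancel]
        exact sub_mem (lie_mem_cyc (s.ideal_succ_le i hpI) (mem_cyc_self _ _))
          (Submodule.smul_mem _ _ (mem_cyc_self _ _)))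
      (hS _ hqM hq)
    exact cyc_le_cyc hmem (ih hd'')

theorem mem_cyc_pow_add_of_ne_zero (hS : IsSimpleGen (s.ideal i.succ) w)
    (hE : s.CobInner f (s.ideal i.succ) w) (hw0 : w ≠ 0)
    (hw : s.IsWeight f (s.ideal i.succ) w)
    (hP : ∀ p ∈ s.vergne f, p ∈ s.ideal i.castSucc → p ∈ s.ideal i.succ)
    (hy : y ∈ s.ideal i.castSucc) (hy' : y ∉ s.ideal i.succ) (n : ℕ) {q d : T}
    (hq : q ∈ cyc (s.ideal i.succ) w) (hq0 : q ≠ 0)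
    (hd : d ∈ adFiltr y (cyc (s.ideal i.succ) w) n) :
    w ∈ cyc (s.ideal i.castSucc) ((LieModule.toEnd K g T y ^ n : Module.End K T) q + d) := by
  obtain ⟨d', hd', hmem⟩ := exists_pow_add_mem (fun x hx m hm => lie_mem_cyc hx hm)
    (W := cyc (s.ideal i.castSucc) ((LieModule.toEnd K g T y ^ n : Module.End K T) q + d))
    (fun x hx m hm => lie_mem_cyc (s.ideal_succ_le i hx) hm) hq hd (mem_cyc_self _ _) (hS q hq hq0)
  exact cyc_le_cyc hmem (mem_cyc_pow_add hS hE hw0 hw hP hy hy' n hd')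

/-- Leading coefficients are well defined: for `q ≠ 0` the vector `y ^ n q - y ^ n q = 0` would
generate `w`. -/
theorem eq_zero_of_pow_mem (hS : IsSimpleGen (s.ideal i.succ) w)
    (hE : s.CobInner f (s.ideal i.succ) w) (hw0 : w ≠ 0)
    (hw : s.IsWeight f (s.ideal i.succ) w)
    (hP : ∀ p ∈ s.vergne f, p ∈ s.ideal i.castSucc → p ∈ s.ideal i.succ)
    (hy : y ∈ s.ideal i.castSucc) (hy' : y ∉ s.ideal i.succ) (n : ℕ) {q : T}
    (hq : q ∈ cyc (s.ideal i.succ) w)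
    (hmem : (LieModule.toEnd K g T y ^ n : Module.End K T) q ∈
      adFiltr y (cyc (s.ideal i.succ) w) n) : q = 0 := by
  by_contra hq0
  have := mem_cyc_pow_add_of_ne_zero hS hE hw0 hw hP hy hy' n hq hq0 (neg_mem hmem)
  rw [add_neg_cancel, cyc_zero, Submodule.mem_bot] at this
  exact hw0 this

theorem IsSimpleGen.castSucc_of_split (hS : IsSimpleGen (s.ideal i.succ) w)
    (hE : s.CobInner f (s.ideal i.succ) w) (hw0 : w ≠ 0)
    (hw : s.IsWeight f (s.ideal i.succ) w)
    (hP : ∀ p ∈ s.vergne f, p ∈ s.ideal i.castSucc → p ∈ s.ideal i.succ)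
    (hy : y ∈ s.ideal i.castSucc) (hy' : y ∉ s.ideal i.succ) :
    IsSimpleGen (s.ideal i.castSucc) w := by
  intro e he he0
  obtain ⟨n, hn⟩ := exists_mem_adFiltr hy hy' he
  induction n with
  | zero => exact absurd ((Submodule.mem_bot K).mp hn) he0
  | succ n ih =>
    obtain ⟨d, hd, m, hm, rfl⟩ := mem_adFiltr_succ.mp hn
    by_cases hm0 : m = 0
    · apply ih
      simpa [hm0] using hd
    · exact mem_cyc_pow_add_of_ne_zero hS hE hw0 hw hP hy hy' n hm hm0 hd

/-- If every `p - f(p)` lowers the degree of `m`, its leading coefficient is a weight vector, hence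
a multiple of `w`. -/
theorem mem_adFiltr_of_lie_sub_mem (hS : IsSimpleGen (s.ideal i.succ) w)
    (hE : s.CobInner f (s.ideal i.succ) w) (hw0 : w ≠ 0)
    (hw : s.IsWeight f (s.ideal i.succ) w)
    (hP : ∀ p ∈ s.vergne f, p ∈ s.ideal i.castSucc → p ∈ s.ideal i.succ)
    (hy : y ∈ s.ideal i.castSucc) (hy' : y ∉ s.ideal i.succ) (n : ℕ) {m : T}
    (hm : m ∈ adFiltr y (cyc (s.ideal i.succ) w) (n + 1))
    (hmp : ∀ p ∈ s.vergne f, p ∈ s.ideal i.succ →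
      ⁅p, m⁆ - f p • m ∈ adFiltr y (cyc (s.ideal i.succ) w) n) :
    ∃ c : K, ∃ d ∈ adFiltr y (cyc (s.ideal i.succ) w) n,
      m = (LieModule.toEnd K g T y ^ n : Module.End K T) (c • w) + d := by
  have hM : ∀ x ∈ s.ideal i.succ, ∀ m ∈ cyc (s.ideal i.succ) w, ⁅x, m⁆ ∈ cyc (s.ideal i.succ) w :=
    fun x hx m hm => lie_mem_cyc hx hm
  obtain ⟨d, hd, q, hq, rfl⟩ := mem_adFiltr_succ.mp hm
  obtain ⟨c, rfl⟩ := hE.exists_eq_smul hw0 hw hq fun p hp hpI => by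
    rw [← sub_eq_zero]
    refine eq_zero_of_pow_mem hS hE hw0 hw hP hy hy' n
      (sub_mem (hM p hpI q hq) (Submodule.smul_mem _ _ hq)) ?_
    have h1 := lie_pow_sub_mem (y := y) hM n hpI hq
    have h2 := lie_mem_adFiltr hM hpI hd
    have h3 := Submodule.smul_mem _ (f p) hd
    convert sub_mem (sub_mem (add_mem (hmp p hp hpI) h3) h1) h2 using 1
    simp only [lie_add, map_sub, map_smul, smul_add]
    abel
  exact ⟨c, d, hd, rfl⟩

theorem CobInner.castSucc_of_split (hS : IsSimpleGen (s.ideal i.succ) w)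
    (hE : s.CobInner f (s.ideal i.succ) w) (hw0 : w ≠ 0)
    (hw : s.IsWeight f (s.ideal i.succ) w)
    (hP : ∀ p ∈ s.vergne f, p ∈ s.ideal i.castSucc → p ∈ s.ideal i.succ)
    (hy : y ∈ s.ideal i.castSucc) (hy' : y ∉ s.ideal i.succ) :
    s.CobInner f (s.ideal i.castSucc) w := by
  have hM : ∀ x ∈ s.ideal i.succ, ∀ m ∈ cyc (s.ideal i.succ) w, ⁅x, m⁆ ∈ cyc (s.ideal i.succ) w :=
    fun x hx m hm => lie_mem_cyc hx hm
  have hwM := mem_cyc_self (s.ideal i.succ) w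
  intro m hm x hx
  replace hx : ∀ p ∈ s.vergne f, p ∈ s.ideal i.succ → ⁅p, m⁆ - f p • m = ⁅⁅x, p⁆, w⁆ :=
    fun p hp hpI => hx p hp (s.ideal_succ_le i hpI)
  have hx1 : ∀ p ∈ s.vergne f, p ∈ s.ideal i.succ →
      ⁅p, m⁆ - f p • m ∈ adFiltr y (cyc (s.ideal i.succ) w) 1 := fun p hp hpI => by
    rw [hx p hp hpI]
    exact pow_mem_adFiltr 0 (hM _ (lie_mem_right K g _ x p hpI) _ hwM)
  -- The right-hand side of the cocycle equation has degree `0`, which forces `m` to have degree at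
  -- most `1` in `y`.
  have hm2 : m ∈ adFiltr y (cyc (s.ideal i.succ) w) 2 := by
    obtain ⟨n, hn⟩ := exists_mem_adFiltr hy hy' hm
    replace hn : m ∈ adFiltr y (cyc (s.ideal i.succ) w) (n + 2) := adFiltr_mono (by lia) hn
    induction n with
    | zero => exact hn
    | succ n ih =>
      obtain ⟨c, d, hd, hmc⟩ := mem_adFiltr_of_lie_sub_mem hS hE hw0 hw hP hy hy' (n + 2) hn
        fun p hp hpI => adFiltr_mono (by lia) (hx1 p hp hpI)
      by_cases hc : c = 0
      · apply ih
        rw [hmc, hc, zero_smul, map_zero, zero_add]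
        exact hd
      -- In degree at least `2`, the second coefficient `q`, suitably rescaled, would solve the
      -- equation excluded by `not_forall_lie_sub_eq`.
      · exfalso
        obtain ⟨d', hd', q, hq, rfl⟩ := mem_adFiltr_succ.mp hd
        have hc' : c * (((n + 1 : ℕ) : K) + 1) ≠ 0 := mul_ne_zero hc (Nat.cast_add_one_ne_zero _)
        refine not_forall_lie_sub_eq hE hw0 hw hP hy hy'
          (Submodule.smul_mem _ (c * (((n + 1 : ℕ) : K) + 1))⁻¹ hq) fun p hp hpI => ?_
        have hpy : ⁅p, y⁆ ∈ s.ideal i.succ := lie_mem_left K g _ p y hpI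
        have hkey := exists_smul_sub_pow_mem (y := y) hw hp hpI hM hwM c hq hd'
        rw [← hmc] at hkey
        have h0 := eq_zero_of_pow_mem hS hE hw0 hw hP hy hy' (n + 1)
          (add_mem (Submodule.smul_mem _ (c * (((n + 1 : ℕ) : K) + 1)) (hM _ hpy _ hwM))
            (sub_mem (hM _ hpI _ hq) (Submodule.smul_mem _ (f p) hq)))
          (by
            have := sub_mem (adFiltr_mono (show 1 ≤ n + 1 by lia) (hx1 p hp hpI)) hkey
            rwa [sub_sub_cancel] at this)
        have h := eq_neg_of_add_eq_zero_right h0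
        rw [lie_smul, smul_comm, ← smul_sub, h, ← smul_neg, smul_smul,
          inv_mul_cancel₀ hc', one_smul, ← neg_lie, lie_skew]
  obtain ⟨c, d, hd, hmc⟩ := mem_adFiltr_of_lie_sub_mem hS hE hw0 hw hP hy hy' 1 hm2 hx1
  obtain ⟨d', hd', q, hq, rfl⟩ := mem_adFiltr_succ.mp hd
  rw [adFiltr, Submodule.mem_bot] at hd'
  rw [hd', add_zero, pow_zero, Module.End.one_apply, pow_one, map_smul,
    LieModule.toEnd_apply_apply] at hmc
  -- Now `m = c y w + q`, and the term `c y w` is absorbed into the derivation. This is why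
  -- `CobInner` allows `x` outside the ideal.
  obtain ⟨z, hz, c', hc'⟩ := hE q hq (x + c • y) fun p hp hpI => by
    have h1 := hx p hp hpI
    rw [hmc, lie_add, lie_smul, leibniz_lie p y w, hw p hp hpI, lie_smul] at h1
    rw [add_lie, add_lie, ← h1, smul_lie, smul_lie, ← lie_skew p y, neg_lie]
    module
  refine ⟨z - c • y, sub_mem (s.ideal_succ_le i hz) (Submodule.smul_mem _ _ hy), c', ?_⟩
  rw [← hc', hmc, sub_lie, smul_lie]
  abel

end Split

end Step

variable [CharZero K]

theorem isSimpleGen_and_cobInner (s : LieFiltration K g k) (f : Module.Dual K g)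
    {w : T} (hw0 : w ≠ 0) (i : Fin (k + 1)) (hw : s.IsWeight f (s.ideal i) w) :
    IsSimpleGen (s.ideal i) w ∧ s.CobInner f (s.ideal i) w := by
  induction i using Fin.reverseInduction with
  | last =>
    have hle : cyc (s.ideal (Fin.last k)) w ≤ K ∙ w := by
      refine cyc_le (Submodule.mem_span_singleton_self w) fun x hx m _ => ?_
      rw [s.eq_zero_of_mem_ideal_last hx, zero_lie]
      exact zero_mem _
    constructor
    · intro e he he0
      obtain ⟨c, rfl⟩ := Submodule.mem_span_singleton.mp (hle he)
      have hc : c ≠ 0 := by rintro rfl; exact he0 (zero_smul K w)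
      have := Submodule.smul_mem _ c⁻¹ (mem_cyc_self (s.ideal (Fin.last k)) (c • w))
      rwa [smul_smul, inv_mul_cancel₀ hc, one_smul] at this
    · intro m hm x _
      obtain ⟨c, rfl⟩ := Submodule.mem_span_singleton.mp (hle hm)
      exact ⟨0, zero_mem _, c, by rw [zero_lie, add_zero]⟩
  | cast i ih =>
    by_cases hle : s.ideal i.castSucc ≤ s.ideal i.succ
    · have heq := le_antisymm hle (s.ideal_succ_le i)
      rw [heq] at hw ⊢
      exact ih hw
    have hw' := hw.mono (s.ideal_succ_le i)
    obtain ⟨hS, hE⟩ := ih hw'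
    by_cases hP : ∀ p ∈ s.vergne f, p ∈ s.ideal i.castSucc → p ∈ s.ideal i.succ
    · obtain ⟨y, hy, hy'⟩ := Set.not_subset.mp hle
      exact ⟨hS.castSucc_of_split hE hw0 hw' hP hy hy', hE.castSucc_of_split hS hw0 hw' hP hy hy'⟩
    · push Not at hP
      obtain ⟨x, hxP, hx, hx'⟩ := hP
      have heq := cyc_castSucc_eq hx hx' (hw x hxP hx)
      constructor
      · intro e he he0
        rw [heq] at he
        exact cyc_mono (s.ideal_succ_le i) e (hS e he he0)
      · intro m hm x hx
        rw [heq] at hm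
        obtain ⟨z, hz, c, hc⟩ := hE m hm x fun p hp hpI => hx p hp (s.ideal_succ_le i hpI)
        exact ⟨z, s.ideal_succ_le i hz, c, hc⟩

theorem isSimpleGen (s : LieFiltration K g k) (f : Module.Dual K g) {w : T} (hw0 : w ≠ 0)
    (i : Fin (k + 1)) (hw : s.IsWeight f (s.ideal i) w) : IsSimpleGen (s.ideal i) w :=
  (s.isSimpleGen_and_cobInner f hw0 i hw).1

theorem exists_eq_smul_of_isWeight (s : LieFiltration K g k) (f : Module.Dual K g) {w : T}
    (hw0 : w ≠ 0) (i : Fin (k + 1)) (hw : s.IsWeight f (s.ideal i) w) {m : T}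
    (hm : m ∈ cyc (s.ideal i) w) (hmw : s.IsWeight f (s.ideal i) m) : ∃ c : K, m = c • w :=
  (s.isSimpleGen_and_cobInner f hw0 i hw).2.exists_eq_smul hw0 hw hm hmw

end Weight

end LieFiltration

/-! ### Existence of weight vectors over algebraically closed fields -/

namespace LieFiltration

section Closed

attribute [local instance] LieRing.ofAssociativeRing

variable {K : Type u} {g : Type v} [Field K] [LieRing g] [LieAlgebra K g] {k : ℕ}
variable {T : Type w} [AddCommGroup T] [Module K T] [LieRingModule g T] [LieModule K g T]

theorem lie_mem_biSup_cyc {I : LieIdeal K g} {ι : Type*} (e : ι → T) (S : Finset ι) {x : g}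
    (hx : x ∈ I) {m : T} (hm : m ∈ ⨆ j ∈ S, cyc I (e j)) : ⁅x, m⁆ ∈ ⨆ j ∈ S, cyc I (e j) := by
  have : (⨆ j ∈ S, cyc I (e j)) ≤
      (⨆ j ∈ S, cyc I (e j)).comap (LieModule.toEnd K g T x : T →ₗ[K] T) :=
    iSup₂_le fun j hj m hm =>
      (le_iSup₂ (f := fun j (_ : j ∈ S) => cyc I (e j)) j hj) (lie_mem_cyc hx hm)
  exact this hm

/-- The form `f` vanishes on brackets of `pv(f)`, so `pv(f)` preserves the weight space. -/
theorem IsWeight.lie {s : LieFiltration K g k} {f : Module.Dual K g} {I : LieIdeal K g} {e : T}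
    (he : s.IsWeight f I e) {x : g} (hx : x ∈ s.vergne f) : s.IsWeight f I ⁅x, e⁆ := by
  intro p hp hpI
  have hpx : ⁅p, x⁆ ∈ I := lie_mem_left K g I p x hpI
  rw [leibniz_lie, he p hp hpI, he _ (LieSubalgebra.lie_mem _ hp hx) hpx, s.lie_vergne f hp hx,
    zero_smul, zero_add, lie_smul]

variable [CharZero K]

/-- The weight vectors in a sum of cyclic submodules generated by weight vectors are linear
combinations of the generators. -/
theorem mem_span_of_isWeight (s : LieFiltration K g k) (f : Module.Dual K g) (i : Fin (k + 1))
    {ι : Type*} (e : ι → T) (he : ∀ j, s.IsWeight f (s.ideal i) (e j)) (S : Finset ι) {m : T}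
    (hm : m ∈ ⨆ j ∈ S, cyc (s.ideal i) (e j)) (hmw : s.IsWeight f (s.ideal i) m) :
    m ∈ Submodule.span K (Set.range e) := by
  classical
  induction S using Finset.induction generalizing m with
  | empty =>
    have : m = 0 := by simpa using hm
    rw [this]
    exact zero_mem _
  | insert a S _ ih =>
    rw [Finset.iSup_insert, Submodule.mem_sup] at hm
    obtain ⟨b, hb, n, hn, rfl⟩ := hm
    have hN := fun x (hx : x ∈ s.ideal i) m hm =>
      lie_mem_biSup_cyc (I := s.ideal i) e S hx (m := m) hm
    -- Either the new generator is redundant, or by simplicity its cyclic module meets the others in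
    -- `0`; then the components `b` and `n` are weight vectors separately.
    by_cases ha : e a ∈ ⨆ j ∈ S, cyc (s.ideal i) (e j)
    · exact ih (add_mem (cyc_le ha hN hb) hn) hmw
    · have ha0 : e a ≠ 0 := fun h => ha (by rw [h]; exact zero_mem _)
      have hdisj : ∀ c ∈ cyc (s.ideal i) (e a), c ∈ ⨆ j ∈ S, cyc (s.ideal i) (e j) → c = 0 := by
        intro c hc hc'
        by_contra hc0
        exact ha (cyc_le hc' hN (s.isSimpleGen f ha0 i (he a) c hc hc0))
      have hb0 : s.IsWeight f (s.ideal i) b := by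
        intro p hp hpI
        rw [← sub_eq_zero]
        refine hdisj _ (sub_mem (lie_mem_cyc hpI hb) (Submodule.smul_mem _ _ hb)) ?_
        have : ⁅p, b⁆ - f p • b = f p • n - ⁅p, n⁆ := by
          have := hmw p hp hpI
          rw [lie_add, smul_add] at this
          rw [sub_eq_sub_iff_add_eq_add, this, add_comm]
        rw [this]
        exact sub_mem (Submodule.smul_mem _ _ hn) (hN p hpI n hn)
      have hn0 : s.IsWeight f (s.ideal i) n := by
        intro p hp hpI
        have := hmw p hp hpI
        rwa [lie_add, smul_add, hb0 p hp hpI, add_right_inj] at this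
      obtain ⟨c, rfl⟩ := s.exists_eq_smul_of_isWeight f ha0 i (he a) hb hb0
      exact add_mem (Submodule.smul_mem _ _ (Submodule.subset_span ⟨a, rfl⟩)) (ih hn hn0)

theorem exists_lie_eq_smul [IsAlgClosed K] (s : LieFiltration K g k) (f : Module.Dual K g)
    {i : Fin k} {x : g} (hxP : x ∈ s.vergne f) (hx : x ∈ s.ideal i.castSucc)
    (hx' : x ∉ s.ideal i.succ) {t : T} (ht : s.IsWeight f (s.ideal i.succ) t)
    (hS : IsSimpleGen (s.ideal i.castSucc) t) : ∃ c : K, ⁅x, t⁆ = c • t := by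
  by_contra! hno
  set X : Module.End K T := LieModule.toEnd K g T x with hX
  have hXa : ∀ m, X m = ⁅x, m⁆ := fun _ => rfl
  -- An eigenvector `e` of `x` would generate `t` already under `g_{i+1}`, so `t` would be a
  -- multiple of `e` and itself an eigenvector.
  have hno' : ∀ e ∈ cyc (s.ideal i.castSucc) t, s.IsWeight f (s.ideal i.succ) e → e ≠ 0 →
      ∀ c : K, ⁅x, e⁆ ≠ c • e := by
    intro e he hew he0 c hc
    have hte := hS e he he0
    rw [cyc_castSucc_eq hx hx' hc] at hte
    obtain ⟨a, rfl⟩ := s.exists_eq_smul_of_isWeight f he0 i.succ hew hte ht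
    exact hno c (by rw [lie_smul, hc, smul_comm])
  -- Split off linear factors one at a time: none of them kills a nonzero weight vector.
  have hpoly : ∀ (n : ℕ) (q : Polynomial K), q.natDegree = n → q ≠ 0 →
      ∀ e ∈ cyc (s.ideal i.castSucc) t, s.IsWeight f (s.ideal i.succ) e → e ≠ 0 →
      Polynomial.aeval X q e ≠ 0 := by
    intro n
    induction n with
    | zero =>
      intro q hq hq0 e _ _ he0
      rw [Polynomial.eq_C_of_natDegree_eq_zero hq, Polynomial.aeval_C, Module.algebraMap_end_apply]
      refine smul_ne_zero (fun h => hq0 ?_) he0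
      rw [Polynomial.eq_C_of_natDegree_eq_zero hq, h, map_zero]
    | succ n ih =>
      intro q hq hq0 e he hew he0
      obtain ⟨c, hc⟩ := IsAlgClosed.exists_root q (by
        intro h
        rw [Polynomial.natDegree_eq_of_degree_eq_some h] at hq
        exact absurd hq (by simp))
      obtain ⟨r, rfl⟩ := Polynomial.dvd_iff_isRoot.mpr hc
      have hr0 : r ≠ 0 := right_ne_zero_of_mul hq0
      rw [Polynomial.natDegree_mul (Polynomial.X_sub_C_ne_zero c) hr0,
        Polynomial.natDegree_X_sub_C, add_comm, add_left_inj] at hq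
      rw [mul_comm, map_mul, Module.End.mul_apply]
      have hval : Polynomial.aeval X (Polynomial.X - Polynomial.C c) e = ⁅x, e⁆ - c • e := by
        simp [hXa]
      rw [hval]
      refine ih r hq hr0 _ (sub_mem (lie_mem_cyc hx he) (Submodule.smul_mem _ _ he)) ?_
        (sub_ne_zero.mpr (hno' e he hew he0 c))
      intro p hp hpI
      rw [lie_sub, lie_smul, hew.lie hxP p hp hpI, hew p hp hpI]
      module
  have ht0 : t ≠ 0 := by
    rintro rfl
    exact hno 0 (by simp)
  have hpow : ∀ n, s.IsWeight f (s.ideal i.succ) ((X ^ n) t) := by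
    intro n
    induction n with
    | zero => exact ht
    | succ n ih =>
      rw [pow_succ', Module.End.mul_apply]
      exact ih.lie hxP
  have hxt : ⁅x, t⁆ ≠ 0 := by simpa using hno 0
  have hmem := hS _ (lie_mem_cyc hx (mem_cyc_self _ t)) hxt
  have hle : cyc (s.ideal i.castSucc) ⁅x, t⁆ ≤ ⨆ n, cyc (s.ideal i.succ) ((X ^ (n + 1)) t) := by
    have hsucc : ∀ y ∈ s.ideal i.succ, ∀ m ∈ ⨆ n, cyc (s.ideal i.succ) ((X ^ (n + 1)) t),
        ⁅y, m⁆ ∈ ⨆ n, cyc (s.ideal i.succ) ((X ^ (n + 1)) t) := by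
      intro y hy
      have : (⨆ n, cyc (s.ideal i.succ) ((X ^ (n + 1)) t)) ≤
          (⨆ n, cyc (s.ideal i.succ) ((X ^ (n + 1)) t)).comap
            (LieModule.toEnd K g T y : T →ₗ[K] T) :=
        iSup_le fun n m hm => Submodule.mem_iSup_of_mem n (lie_mem_cyc hy hm)
      exact fun m hm => this hm
    have hself : ∀ m ∈ ⨆ n, cyc (s.ideal i.succ) ((X ^ (n + 1)) t),
        ⁅x, m⁆ ∈ ⨆ n, cyc (s.ideal i.succ) ((X ^ (n + 1)) t) := by
      have : (⨆ n, cyc (s.ideal i.succ) ((X ^ (n + 1)) t)) ≤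
          (⨆ n, cyc (s.ideal i.succ) ((X ^ (n + 1)) t)) ⊓
          (⨆ n, cyc (s.ideal i.succ) ((X ^ (n + 1)) t)).comap X := by
        refine iSup_le fun n => cyc_le ⟨Submodule.mem_iSup_of_mem n (mem_cyc_self _ _), ?_⟩ ?_
        · rw [SetLike.mem_coe, Submodule.mem_comap, ← Module.End.mul_apply, ← pow_succ']
          exact Submodule.mem_iSup_of_mem (n + 1) (mem_cyc_self _ _)
        · rintro z hz m ⟨hm, hm'⟩
          refine ⟨hsucc z hz m hm, ?_⟩
          rw [SetLike.mem_coe, Submodule.mem_comap, hXa] at hm' ⊢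
          rw [leibniz_lie]
          exact add_mem (hsucc _ (lie_mem_right K g _ x z hz) _ hm) (hsucc z hz _ hm')
      exact fun m hm => (this hm).2
    refine cyc_le (Submodule.mem_iSup_of_mem 0 ?_) ?_
    · rw [zero_add, pow_one, hXa]
      exact mem_cyc_self _ _
    · intro z hz m hm
      obtain ⟨a, ha⟩ := s.exists_sub_smul_mem i hx hx' hz
      rw [← sub_add_cancel z (a • x), add_lie, smul_lie]
      exact add_mem (hsucc _ ha m hm) (Submodule.smul_mem _ _ (hself m hm))
  -- Since `x t` generates `t`, the weight vector `t` is a combination of the `x ^ (n + 1) t`. So `1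
  -- - X r(X)`, nonzero because its constant term is `1`, annihilates `t`.
  obtain ⟨S, hSt⟩ := (Submodule.mem_iSup_iff_exists_finset).mp (hle hmem)
  have hspan := s.mem_span_of_isWeight f i.succ (fun n => (X ^ (n + 1)) t)
    (fun n => hpow (n + 1)) S hSt ht
  have hr : ∀ a ∈ Submodule.span K (Set.range fun n => (X ^ (n + 1)) t),
      ∃ r : Polynomial K, Polynomial.aeval X (Polynomial.X * r) t = a := by
    intro a ha
    induction ha using Submodule.span_induction with
    | mem m hm =>
      obtain ⟨n, rfl⟩ := hm
      exact ⟨Polynomial.X ^ n, by rw [← pow_succ', map_pow, Polynomial.aeval_X]⟩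
    | zero => exact ⟨0, by simp⟩
    | add a b _ _ ha hb =>
      obtain ⟨r, hr⟩ := ha
      obtain ⟨r', hr'⟩ := hb
      exact ⟨r + r', by rw [mul_add, map_add, LinearMap.add_apply, hr, hr']⟩
    | smul c a _ ha =>
      obtain ⟨r, hr⟩ := ha
      exact ⟨c • r, by rw [mul_smul_comm, map_smul, LinearMap.smul_apply, hr]⟩
  obtain ⟨r, hr⟩ := hr t hspan
  refine hpoly _ (1 - Polynomial.X * r) rfl ?_ t (mem_cyc_self _ _) ht ht0 ?_
  · intro h
    have := congrArg (Polynomial.eval 0) h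
    simp at this
  · rw [map_sub, LinearMap.sub_apply, hr, map_one, Module.End.one_apply, sub_self]

/-- Over an algebraically closed field, if `t` generates irreducible `g_i`-modules for all `i`, then
it is a weight vector for the Vergne polarization of some linear form. -/
theorem exists_isWeight_of_isSimpleGen [IsAlgClosed K] (s : LieFiltration K g k) {t : T}
    (ht0 : t ≠ 0) (hS : ∀ i, IsSimpleGen (s.ideal i) t) :
    ∃ f : Module.Dual K g, ∀ p ∈ s.vergne f, ⁅p, t⁆ = f p • t := by
  -- With `l t = 1`, the form `p ↦ l(p t)` returns the eigenvalue whenever `t` is an eigenvector of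
  -- `p`.
  obtain ⟨l, hl⟩ := Module.Projective.exists_dual_eq_one K ht0
  let f : Module.Dual K g := l.comp ((LieModule.toEnd K g T).toLinearMap.flip t)
  have hf : ∀ p, f p = l ⁅p, t⁆ := fun _ => rfl
  have key : ∀ i, s.IsWeight f (s.ideal i) t := by
    intro i
    induction i using Fin.reverseInduction with
    | last =>
      intro p _ hp
      rw [s.eq_zero_of_mem_ideal_last hp, zero_lie, map_zero, zero_smul]
    | cast i ih =>
      intro p hp hpi
      by_cases hpi' : p ∈ s.ideal i.succ
      · exact ih p hp hpi'
      · obtain ⟨c, hc⟩ := s.exists_lie_eq_smul f hp hpi hpi' ih (hS _)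
        rw [hf, hc, map_smul, hl, smul_eq_mul, mul_one]
  exact ⟨f, fun p hp => key 0 p hp (s.mem_ideal_zero p)⟩

end Closed

end LieFiltration

/-! ### Characters of subalgebras occur in modules over `g` -/

section Extend

variable {K : Type u} {g : Type v} [Field K] [LieRing g] [LieAlgebra K g]

section ExtendStep

variable {V : Type w} [AddCommGroup V] [Module K V]

attribute [local instance] LieRing.ofAssociativeRing

/-- The coefficients of the action of `g` on `V[t]` that extends a given action on `V` of a
subalgebra, the kernel of `l`, by letting `x` act as multiplication by `t`. -/
noncomputable def extendCoeff (ρ : g →ₗ[K] Module.End K V) (l : Module.Dual K g) (x : g) :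
    ℕ → g →ₗ[K] V →ₗ[K] (ℕ →₀ V)
  | 0 => (ρ ∘ₗ (LinearMap.id - l.smulRight x)).compr₂ (Finsupp.lsingle 0) +
      l.smulRight (Finsupp.lsingle 1)
  | n + 1 => (extendCoeff ρ l x n).compr₂ (Finsupp.lmapDomain V K Nat.succ) -
      extendCoeff ρ l x n ∘ₗ (LieAlgebra.ad K g x : g →ₗ[K] g)

/-- The action of `g` on `V[t]` with coefficients `extendCoeff`. -/
noncomputable def extendAction (ρ : g →ₗ[K] Module.End K V) (l : Module.Dual K g) (x : g) :
    g →ₗ[K] Module.End K (ℕ →₀ V) where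
  toFun y := Finsupp.lsum K fun n => extendCoeff ρ l x n y
  map_add' y z := by
    refine Finsupp.lhom_ext fun n a => ?_
    simp
  map_smul' c y := by
    refine Finsupp.lhom_ext fun n a => ?_
    simp

variable (ρ : g →ₗ[K] Module.End K V) (l : Module.Dual K g) (x : g)

theorem extendAction_single (y : g) (n : ℕ) (a : V) :
    extendAction ρ l x y (Finsupp.single n a) = extendCoeff ρ l x n y a := by
  simp [extendAction]

theorem extendAction_mapDomain (y : g) (m : ℕ →₀ V) :
    extendAction ρ l x y (Finsupp.lmapDomain V K Nat.succ m) =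
      Finsupp.lmapDomain V K Nat.succ (extendAction ρ l x y m) - extendAction ρ l x ⁅x, y⁆ m := by
  induction m using Finsupp.induction_linear with
  | zero => simp
  | add a b ha hb => rw [map_add, map_add, ha, hb, map_add, map_add, map_add]; abel
  | single n a =>
    rw [Finsupp.lmapDomain_apply, Finsupp.mapDomain_single, extendAction_single,
      extendAction_single, extendAction_single]
    rfl

theorem extendAction_self (hl : l x = 1) :
    extendAction ρ l x x = Finsupp.lmapDomain V K Nat.succ := by
  ext n a : 2
  rw [LinearMap.comp_apply, LinearMap.comp_apply, Finsupp.lsingle_apply, extendAction_single]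
  induction n with
  | zero => simp [extendCoeff, hl]
  | succ n ih => simp [extendCoeff, ih]

theorem extendAction_zero_of_mem {y : g} (hy : l y = 0) (a : V) :
    extendAction ρ l x y (Finsupp.single 0 a) = Finsupp.single 0 (ρ y a) := by
  simp [extendAction_single, extendCoeff, hy]

/-- Brackets with `x` are respected by construction. In degree `0`, subtracting multiples of `x`
reduces to `H`; higher degrees follow by induction from the Jacobi identity. -/
theorem extendAction_lie (hl : l x = 1) {H H' : LieSubalgebra K g} (hH : ∀ y ∈ H, l y = 0)
    (hx : x ∈ H') (hHx : ∀ y ∈ H', ∃ c : K, y - c • x ∈ H)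
    (hρ : ∀ y ∈ H, ∀ z ∈ H, ρ ⁅y, z⁆ = ρ y * ρ z - ρ z * ρ y) {y z : g} (hy : y ∈ H')
    (hz : z ∈ H') (m : ℕ →₀ V) :
    extendAction ρ l x ⁅y, z⁆ m = extendAction ρ l x y (extendAction ρ l x z m) -
      extendAction ρ l x z (extendAction ρ l x y m) := by
  set σ := extendAction ρ l x with hσ
  set t : (ℕ →₀ V) →ₗ[K] (ℕ →₀ V) := Finsupp.lmapDomain V K Nat.succ with ht
  have ht' : ∀ y m, σ y (t m) = t (σ y m) - σ ⁅x, y⁆ m := extendAction_mapDomain ρ l x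
  have hxt : σ x = t := extendAction_self ρ l x hl
  have hxl : ∀ z m, σ ⁅x, z⁆ m = σ x (σ z m) - σ z (σ x m) := fun z m => by
    rw [hxt, ht']; abel
  have hxr : ∀ z m, σ ⁅z, x⁆ m = σ z (σ x m) - σ x (σ z m) := fun z m => by
    rw [← lie_skew, map_neg, LinearMap.neg_apply, hxl]; abel
  have key : ∀ (n : ℕ) (a : V), ∀ y ∈ H', ∀ z ∈ H',
      σ ⁅y, z⁆ (Finsupp.single n a) =
        σ y (σ z (Finsupp.single n a)) - σ z (σ y (Finsupp.single n a)) := by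
    intro n a
    induction n with
    | zero =>
      intro y hy z hz
      obtain ⟨c, hc⟩ := hHx y hy
      obtain ⟨d, hd⟩ := hHx z hz
      have h0 : σ ⁅y - c • x, z - d • x⁆ (Finsupp.single 0 a) =
          σ (y - c • x) (σ (z - d • x) (Finsupp.single 0 a)) -
            σ (z - d • x) (σ (y - c • x) (Finsupp.single 0 a)) := by
        rw [hσ, extendAction_zero_of_mem ρ l x (hH _ (LieSubalgebra.lie_mem _ hc hd)),
          extendAction_zero_of_mem ρ l x (hH _ hd), extendAction_zero_of_mem ρ l x (hH _ hc),
          extendAction_zero_of_mem ρ l x (hH _ hc), extendAction_zero_of_mem ρ l x (hH _ hd),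
          hρ _ hc _ hd, ← Finsupp.single_sub]
        rfl
      simp only [lie_sub, sub_lie, lie_smul, smul_lie, lie_self, smul_zero, sub_zero, map_sub,
        map_smul, LinearMap.sub_apply, LinearMap.smul_apply, hxl, hxr] at h0
      rw [← sub_eq_zero] at h0 ⊢
      rw [← h0]
      module
    | succ n ih =>
      intro y hy z hz
      have hs : Finsupp.single (n + 1) a = t (Finsupp.single n a) := by
        rw [ht, Finsupp.lmapDomain_apply, Finsupp.mapDomain_single]
      have hxy := LieSubalgebra.lie_mem _ hx hy
      have hxz := LieSubalgebra.lie_mem _ hx hz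
      rw [hs, ht', ht', ht', map_sub, map_sub, ht', ht', ih y hy z hz, leibniz_lie x y z, map_add,
        LinearMap.add_apply, ih _ hxy z hz, ih y hy _ hxz, map_sub]
      abel
  induction m using Finsupp.induction_linear with
  | zero => simp
  | add a b ha hb => simp only [map_add, ha, hb]; abel
  | single n a => exact key n a y hy z hz

end ExtendStep

/-- There is a linear map from `g` to the endomorphisms of a vector space that is a representation
on the subalgebra `H` and has a nonzero vector on which `P` acts by `χ`. -/
def ExtendsTo (P : LieSubalgebra K g) (χ : Module.Dual K g) (H : LieSubalgebra K g) : Prop :=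
  ∃ (V : Type u) (_ : AddCommGroup V) (_ : Module K V) (ρ : g →ₗ[K] Module.End K V) (a : V),
    a ≠ 0 ∧ (∀ y ∈ H, ∀ z ∈ H, ρ ⁅y, z⁆ = ρ y * ρ z - ρ z * ρ y) ∧ ∀ p ∈ P, ρ p a = χ p • a

/-- In `V[t]`, the element `t ^ n a` plays the role of `x ^ n ⊗ a` in an induced module. The old
vector sits in degree `0`, where `H` acts as before. -/
theorem ExtendsTo.step {P H H' : LieSubalgebra K g} {χ : Module.Dual K g} (h : ExtendsTo P χ H)
    (hPH : P ≤ H) {x : g} (hx : x ∈ H') (hxH : x ∉ H)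
    (hHx : ∀ y ∈ H', ∃ c : K, y - c • x ∈ H) : ExtendsTo P χ H' := by
  obtain ⟨V, _, _, ρ, a, ha, hρ, hP⟩ := h
  obtain ⟨l₀, hl₀, hH₀⟩ := Submodule.exists_dual_map_eq_bot_of_notMem (p := H.toSubmodule) hxH
    inferInstance
  let l : Module.Dual K g := (l₀ x)⁻¹ • l₀
  have hl : l x = 1 := inv_mul_cancel₀ hl₀
  have hH : ∀ y ∈ H, l y = 0 := fun y hy => by
    have : l₀ y ∈ H.toSubmodule.map l₀ := ⟨y, hy, rfl⟩
    rw [hH₀, Submodule.mem_bot] at this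
    change (l₀ x)⁻¹ * l₀ y = 0
    rw [this, mul_zero]
  refine ⟨ℕ →₀ V, inferInstance, inferInstance, extendAction ρ l x, Finsupp.single 0 a,
    by simpa using ha, fun y hy z hz => LinearMap.ext fun m => ?_, fun p hp => ?_⟩
  · exact extendAction_lie ρ l x hl hH hx hHx hρ hy hz m
  · rw [extendAction_zero_of_mem ρ l x (hH p (hPH hp)), hP p hp, Finsupp.smul_single]

/-- The subalgebra `P + I` for a subalgebra `P` and an ideal `I`. -/
def supIdeal (P : LieSubalgebra K g) (I : LieIdeal K g) : LieSubalgebra K g :=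
  { P.toSubmodule ⊔ I.toSubmodule with
    lie_mem' := by
      intro a b ha hb
      change a ∈ P.toSubmodule ⊔ I.toSubmodule at ha
      change b ∈ P.toSubmodule ⊔ I.toSubmodule at hb
      obtain ⟨p, hp, z, hz, rfl⟩ := Submodule.mem_sup.mp ha
      obtain ⟨q, hq, y, hy, rfl⟩ := Submodule.mem_sup.mp hb
      change ⁅p + z, q + y⁆ ∈ P.toSubmodule ⊔ I.toSubmodule
      rw [add_lie, lie_add, add_assoc]
      exact Submodule.add_mem_sup (P.lie_mem hp hq) (add_mem (lie_mem_right K g I p y hy)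
        (lie_mem_left K g I z _ hz)) }

theorem mem_supIdeal {P : LieSubalgebra K g} {I : LieIdeal K g} {x : g} :
    x ∈ supIdeal P I ↔ ∃ p ∈ P, ∃ z ∈ I, p + z = x :=
  Submodule.mem_sup

/-- Every character of a subalgebra of `g` is the restriction of a weight of a `g`-module. -/
theorem LieFiltration.extendsTo_supIdeal {k : ℕ} (s : LieFiltration K g k) {P : LieSubalgebra K g}
    {χ : Module.Dual K g} (hχ : ∀ x ∈ P, ∀ y ∈ P, χ ⁅x, y⁆ = 0) (i : Fin (k + 1)) :
    ExtendsTo P χ (supIdeal P (s.ideal i)) := by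
  have hle : ∀ i, P ≤ supIdeal P (s.ideal i) := fun i p hp =>
    mem_supIdeal.mpr ⟨p, hp, 0, zero_mem _, add_zero p⟩
  have hle' : ∀ i, ∀ z ∈ s.ideal i, z ∈ supIdeal P (s.ideal i) := fun i z hz =>
    mem_supIdeal.mpr ⟨0, zero_mem _, z, hz, zero_add z⟩
  induction i using Fin.reverseInduction with
  | last =>
    have hP : ∀ x ∈ supIdeal P (s.ideal (Fin.last k)), x ∈ P := by
      intro x hx
      obtain ⟨p, hp, z, hz, rfl⟩ := mem_supIdeal.mp hx
      rwa [s.eq_zero_of_mem_ideal_last hz, add_zero]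
    refine ⟨K, inferInstance, inferInstance, χ.smulRight LinearMap.id, 1, one_ne_zero, ?_, ?_⟩
    · intro y hy z hz
      ext
      simp [hχ y (hP y hy) z (hP z hz), mul_comm]
    · intro p _
      simp
  | cast i ih =>
    by_cases hi : ∀ z ∈ s.ideal i.castSucc, z ∈ supIdeal P (s.ideal i.succ)
    · obtain ⟨V, hV, hV', ρ, a, ha, hρ, hPρ⟩ := ih
      have hle₂ : ∀ x ∈ supIdeal P (s.ideal i.castSucc), x ∈ supIdeal P (s.ideal i.succ) := by
        intro x hx
        obtain ⟨p, hp, z, hz, rfl⟩ := mem_supIdeal.mp hx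
        exact add_mem (hle _ hp) (hi z hz)
      exact ⟨V, hV, hV', ρ, a, ha, fun y hy z hz => hρ y (hle₂ y hy) z (hle₂ z hz), hPρ⟩
    · push Not at hi
      obtain ⟨x, hx, hx'⟩ := hi
      refine ih.step (hle _) (hle' _ x hx) hx' fun y hy => ?_
      obtain ⟨p, hp, z, hz, rfl⟩ := mem_supIdeal.mp hy
      obtain ⟨c, hc⟩ := s.exists_sub_smul_mem i hx (fun h => hx' (hle' _ x h)) hz
      refine ⟨c, ?_⟩
      rw [add_sub_assoc]
      exact add_mem (hle _ hp) (hle' _ _ hc)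

end Extend

/-! ### Universal property and generators of induced modules -/

section IndLift

attribute [local instance] LieRing.ofAssociativeRing

variable {K : Type u} {g : Type v} [Field K] [LieRing g] [LieAlgebra K g]

/-- The universal property of the induced module. -/
theorem Ind.exists_lift {h : LieSubalgebra K g} {W : Type w} [AddCommGroup W] [Module K W]
    [LieRingModule h W] [LieModule K h W] {T : Type w'} [AddCommGroup T] [Module K T]
    [LieRingModule g T] [LieModule K g T] (ψ : W →ₗ[K] T)
    (hψ : ∀ (x : h) (y : W), ψ ⁅x, y⁆ = ⁅(x : g), ψ y⁆) :
    ∃ φ : Ind h W →ₗ⁅K, g⁆ T, ∀ y, φ (Ind.tmul h 1 y) = ψ y := by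
  let Φ : UniversalEnvelopingAlgebra K g →ₐ[K] Module.End K T :=
    UniversalEnvelopingAlgebra.lift K (LieModule.toEnd K g T)
  let _ : Module (UniversalEnvelopingAlgebra K g) T := Module.compHom T Φ.toRingHom
  have hsmul : ∀ (a : UniversalEnvelopingAlgebra K g) (m : T), a • m = Φ a m := fun _ _ => rfl
  have hι : ∀ (x : g) (m : T), UniversalEnvelopingAlgebra.ι K x • m = ⁅x, m⁆ := fun x m => by
    rw [hsmul, UniversalEnvelopingAlgebra.lift_ι_apply]
    rfl
  let L₀ : UniversalEnvelopingAlgebra K g ⊗[K] W →ₗ[K] T :=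
    TensorProduct.lift ((LinearMap.lcomp K T ψ).comp Φ.toLinearMap)
  have hL₀ : ∀ a y, L₀ (a ⊗ₜ[K] y) = a • ψ y := fun _ _ => rfl
  let L : UniversalEnvelopingAlgebra K g ⊗[K] W →ₗ[UniversalEnvelopingAlgebra K g] T :=
    { toFun := L₀
      map_add' := map_add L₀
      map_smul' := by
        intro a m
        rw [RingHom.id_apply]
        induction m using TensorProduct.induction_on with
        | zero => simp
        | tmul b y => rw [TensorProduct.smul_tmul', hL₀, hL₀, smul_smul, smul_eq_mul]
        | add m n hm hn => rw [smul_add, map_add, hm, hn, map_add, smul_add] }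
  have henv : ∀ (a : UniversalEnvelopingAlgebra K h) (y : W),
      ψ (UniversalEnvelopingAlgebra.lift K (LieModule.toEnd K h W) a y) = envMap h a • ψ y := by
    intro a
    have ha : a ∈ envIdeal (⊤ : LieIdeal K h) := by rw [envIdeal_top]; trivial
    induction ha using Algebra.adjoin_induction with
    | mem a ha =>
      obtain ⟨x, -, rfl⟩ := ha
      intro y
      rw [UniversalEnvelopingAlgebra.lift_ι_apply, envMap, UniversalEnvelopingAlgebra.lift_ι_apply]
      exact (hψ x y).trans (hι x (ψ y)).symm
    | algebraMap r =>
      intro y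
      rw [AlgHom.commutes, AlgHom.commutes, hsmul, AlgHom.commutes, Module.algebraMap_end_apply,
        Module.algebraMap_end_apply, map_smul]
    | add a b _ _ ha hb =>
      intro y
      rw [map_add, map_add, add_smul, LinearMap.add_apply, map_add, ha, hb]
    | mul a b _ _ ha hb =>
      intro y
      rw [map_mul, map_mul, mul_smul, Module.End.mul_apply, ha, hb]
  have hL : indRel h W ≤ LinearMap.ker L := by
    refine Submodule.span_le.mpr ?_
    rintro _ ⟨a, b, y, rfl⟩
    rw [SetLike.mem_coe, LinearMap.mem_ker, map_sub, sub_eq_zero]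
    change L₀ _ = L₀ _
    rw [hL₀, hL₀, henv, smul_smul]
  let φ₀ : Ind h W →ₗ[UniversalEnvelopingAlgebra K g] T := (indRel h W).liftQ L hL
  have hφ₀ : ∀ a y, φ₀ (Ind.tmul h a y) = a • ψ y := fun _ _ => rfl
  refine ⟨{ toFun := φ₀, map_add' := map_add φ₀, map_smul' := ?_, map_lie' := ?_ }, fun y => ?_⟩
  · intro c m
    have h1 : c • m = algebraMap K (UniversalEnvelopingAlgebra K g) c • m :=
      (algebraMap_smul _ c m).symm
    rw [h1, map_smul, hsmul, AlgHom.commutes, Module.algebraMap_end_apply]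
    rfl
  · intro x m
    change φ₀ (UniversalEnvelopingAlgebra.ι K x • m) = ⁅x, φ₀ m⁆
    rw [map_smul, hι]
  · change φ₀ _ = _
    rw [hφ₀, one_smul]

end IndLift

section Induced

attribute [local instance] LieRing.ofAssociativeRing

variable {K : Type u} {g : Type v} [Field K] [LieRing g] [LieAlgebra K g]

namespace Ind

variable (h : LieSubalgebra K g) {W : Type w} [AddCommGroup W] [Module K W]
    [LieRingModule h W] [LieModule K h W]

/-- The linear map `y ↦ 1 ⊗ y` from `W` to `ind(W, g)`. -/
noncomputable def oneTmul : W →ₗ[K] Ind h W where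
  toFun y := tmul h 1 y
  map_add' y z := by
    change Submodule.Quotient.mk _ = Submodule.Quotient.mk _ + Submodule.Quotient.mk _
    rw [TensorProduct.tmul_add, Submodule.Quotient.mk_add]
    rfl
  map_smul' c y := by
    change Submodule.Quotient.mk _ = c • (Submodule.Quotient.mk _ : Ind h W)
    rw [TensorProduct.tmul_smul]
    rfl

theorem oneTmul_apply (y : W) : oneTmul h y = tmul h 1 y := rfl

theorem lie_oneTmul (x : h) (y : W) : ⁅(x : g), oneTmul h y⁆ = oneTmul h ⁅x, y⁆ := by
  rw [oneTmul_apply, oneTmul_apply, lie_eq_smul, smul_tmul]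
  refine (Submodule.Quotient.eq _).mpr (Submodule.subset_span
    ⟨1, UniversalEnvelopingAlgebra.ι K x, y, ?_⟩)
  rw [envMap, UniversalEnvelopingAlgebra.lift_ι_apply, UniversalEnvelopingAlgebra.lift_ι_apply,
    mul_one, one_mul]
  rfl

end Ind

theorem smul_mem_of_mem_envIdeal {h : LieSubalgebra K g} {W : Type w} [AddCommGroup W] [Module K W]
    [LieRingModule h W] [LieModule K h W] {I : LieIdeal K g} {N : Submodule K (Ind h W)}
    (hN : ∀ x ∈ I, ∀ m ∈ N, ⁅x, m⁆ ∈ N) {a : UniversalEnvelopingAlgebra K g} (ha : a ∈ envIdeal I)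
    {m : Ind h W} (hm : m ∈ N) : a • m ∈ N := by
  induction ha using Algebra.adjoin_induction generalizing m with
  | mem a ha =>
    obtain ⟨x, hx, rfl⟩ := ha
    exact hN x hx m hm
  | algebraMap r =>
    rw [algebraMap_smul]
    exact Submodule.smul_mem _ _ hm
  | add a b _ _ ha hb => rw [add_smul]; exact add_mem (ha hm) (hb hm)
  | mul a b _ _ ha hb => rw [mul_smul]; exact ha (hb hm)

/-- Termwise generation by one vector survives induction. It is used twice: from the character to
`M_s(f)`, and from `N_s(η)` to `ind(N_s(η), g)`. -/
theorem ModuleFiltration.ind_sub_eq_cyc {k : ℕ} {s : LieFiltration K g k} {h : LieSubalgebra K g}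
    {W : Type w} [AddCommGroup W] [Module K W] [LieRingModule h W] [LieModule K h W]
    (F : ModuleFiltration (s.restrict h) W) {y : W}
    (hF : ∀ i, (F.sub i).toSubmodule = cyc ((s.restrict h).ideal i) y) (i : Fin (k + 1)) :
    (F.ind.sub i).toSubmodule = cyc (s.ideal i) (Ind.oneTmul h y) := by
  apply le_antisymm
  · change Submodule.span K _ ≤ _
    refine Submodule.span_le.mpr ?_
    rintro _ ⟨a, ha, z, hz, rfl⟩
    have h1 : (F.sub i).toSubmodule ≤ (cyc (s.ideal i) (Ind.oneTmul h y)).comap (Ind.oneTmul h) := by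
      rw [hF i]
      refine cyc_le (mem_cyc_self _ _) fun x hx m hm => ?_
      rw [Submodule.mem_comap] at hm ⊢
      rw [← Ind.lie_oneTmul]
      exact lie_mem_cyc hx hm
    have h2 := smul_mem_of_mem_envIdeal (fun x hx m hm => lie_mem_cyc hx hm) ha (h1 hz)
    change Ind.tmul h (a * 1) z ∈ _ at h2
    rwa [mul_one] at h2
  · refine cyc_le (Submodule.subset_span ⟨1, one_mem _, y, ?_, rfl⟩) fun x hx m hm => ?_
    · change y ∈ (F.sub i).toSubmodule
      rw [hF i]
      exact mem_cyc_self _ _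
    · exact (F.ind.sub i).lie_mem (x := ⟨x, hx⟩) hm

/-- The generator `1` of a one-dimensional module. -/
def CharModule.one {L : Type v} [LieRing L] [LieAlgebra K L] (χ : LieAlgebra.LieCharacter K L) :
    CharModule χ := (1 : K)

theorem CharModule.top_eq_cyc {L : Type v} [LieRing L] [LieAlgebra K L]
    (χ : LieAlgebra.LieCharacter K L) (I : LieIdeal K L) :
    (⊤ : Submodule K (CharModule χ)) = cyc I (CharModule.one χ) := by
  refine (eq_top_iff.mpr fun c _ => ?_).symm
  have : c = (show K from c) • CharModule.one χ := (mul_one (show K from c)).symm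
  rw [this]
  exact Submodule.smul_mem _ _ (mem_cyc_self _ _)

end Induced

theorem map_cyc {K : Type u} {g : Type v} [Field K] [LieRing g] [LieAlgebra K g]
    {V : Type w} [AddCommGroup V] [Module K V] [LieRingModule g V]
    {T : Type w'} [AddCommGroup T] [Module K T] [LieRingModule g T]
    (φ : V →ₗ⁅K, g⁆ T) (I : LieIdeal K g) (e : V) :
    (cyc I e).map (φ : V →ₗ[K] T) = cyc I (φ e) := by
  apply le_antisymm
  · rw [Submodule.map_le_iff_le_comap]
    refine cyc_le (mem_cyc_self _ _) fun x hx m hm => ?_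
    rw [Submodule.mem_comap] at hm ⊢
    change φ ⁅x, m⁆ ∈ _
    rw [LieModuleHom.map_lie]
    exact lie_mem_cyc hx hm
  · refine cyc_le ⟨e, mem_cyc_self _ _, rfl⟩ ?_
    rintro x hx _ ⟨m, hm, rfl⟩
    exact ⟨⁅x, m⁆, lie_mem_cyc hx hm, LieModuleHom.map_lie φ x m⟩

/-! ### Canonical generators, factors and the spectrum -/

section Vergne

attribute [local instance] LieRing.ofAssociativeRing

variable {K : Type u} {g : Type v} [Field K] [LieRing g] [LieAlgebra K g] {k : ℕ}

namespace LieFiltration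

/-- The canonical generator of `M_s(f)`. -/
noncomputable def gen (s : LieFiltration K g k) (f : Module.Dual K g) : s.M f :=
  Ind.oneTmul (s.vergne f) (CharModule.one (s.vergneChar f))

theorem filtM_sub_eq_cyc (s : LieFiltration K g k) (f : Module.Dual K g) (i : Fin (k + 1)) :
    ((s.filtM f).sub i).toSubmodule = cyc (s.ideal i) (s.gen f) :=
  ModuleFiltration.ind_sub_eq_cyc _ (fun _ => CharModule.top_eq_cyc _ _) i

theorem lie_gen (s : LieFiltration K g k) (f : Module.Dual K g) {p : g} (hp : p ∈ s.vergne f) :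
    ⁅p, s.gen f⁆ = f p • s.gen f := by
  rw [gen, Ind.lie_oneTmul (s.vergne f) ⟨p, hp⟩, CharModule.lie_eq_smul, map_smul]
  rfl

theorem exists_hom_of_lie_eq (s : LieFiltration K g k) (f : Module.Dual K g)
    {T : Type w} [AddCommGroup T] [Module K T] [LieRingModule g T] [LieModule K g T] {t : T}
    (ht : ∀ p ∈ s.vergne f, ⁅p, t⁆ = f p • t) : ∃ φ : s.M f →ₗ⁅K, g⁆ T, φ (s.gen f) = t := by
  let ψ : CharModule (s.vergneChar f) →ₗ[K] T := (LinearMap.toSpanSingleton K T t : K →ₗ[K] T)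
  have hψ : ∀ c : K, ψ c = c • t := fun _ => rfl
  obtain ⟨φ, hφ⟩ := Ind.exists_lift (h := s.vergne f) ψ (by
    intro x c
    rw [CharModule.lie_eq_smul, map_smul]
    change f x • (show K from c) • t = ⁅(x : g), (show K from c) • t⁆
    rw [lie_smul, ht x x.2, smul_comm])
  exact ⟨φ, (hφ _).trans (one_smul K t)⟩

/-- The generator maps to a nonzero weight vector in the module supplied by `extendsTo_supIdeal`. -/
theorem gen_ne_zero (s : LieFiltration K g k) (f : Module.Dual K g) : s.gen f ≠ 0 := by
  obtain ⟨V, _, _, ρ, a, ha, hρ, hP⟩ := s.extendsTo_supIdeal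
    (P := s.vergne f) (χ := f) (fun x hx y hy => s.lie_vergne f hx hy) 0
  have htop : ∀ y, y ∈ supIdeal (s.vergne f) (s.ideal 0) := fun y =>
    mem_supIdeal.mpr ⟨0, zero_mem _, y, s.mem_ideal_zero y, zero_add y⟩
  let _ : LieRingModule g V :=
    { bracket := fun x m => ρ x m
      add_lie := fun x y m => by
        rw [map_add, LinearMap.add_apply]
      lie_add := fun x m n => map_add (ρ x) m n
      leibniz_lie := fun x y m => by
        change ρ x (ρ y m) = ρ ⁅x, y⁆ m + ρ y (ρ x m)
        rw [hρ x (htop x) y (htop y), LinearMap.sub_apply]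
        exact (sub_add_cancel _ _).symm }
  have _ : LieModule K g V :=
    { smul_lie := fun c x m => by
        change ρ (c • x) m = _
        rw [map_smul]
        rfl
      lie_smul := fun c x m => map_smul (ρ x) c m }
  obtain ⟨φ, hφ⟩ := s.exists_hom_of_lie_eq f (t := a) hP
  intro h0
  rw [h0, map_zero] at hφ
  exact ha hφ.symm

end LieFiltration

namespace ModuleFiltration

variable {s : LieFiltration K g k}
variable {V : Type w} [AddCommGroup V] [Module K V] [LieRingModule g V] [LieModule K g V]
variable {T : Type w'} [AddCommGroup T] [Module K T] [LieRingModule g T] [LieModule K g T]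

theorem isIrreducible_of_sub_eq_cyc (G : ModuleFiltration s T) {t : T} (ht0 : t ≠ 0)
    (hG : ∀ i, (G.sub i).toSubmodule = cyc (s.ideal i) t)
    (hS : ∀ i, LieFiltration.IsSimpleGen (s.ideal i) t) : G.IsIrreducible := by
  intro i
  have hmem : ∀ m, m ∈ G.sub i ↔ m ∈ cyc (s.ideal i) t := fun m => by rw [← hG i]; rfl
  have : Nontrivial (G.sub i) :=
    ⟨⟨⟨t, (hmem t).mpr (mem_cyc_self _ _)⟩, 0, fun h => ht0 (congrArg Subtype.val h)⟩⟩
  refine LieModule.IsIrreducible.mk fun N hN => ?_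
  rw [ne_eq, LieSubmodule.eq_bot_iff] at hN
  push Not at hN
  obtain ⟨e, he, he0⟩ := hN
  have ht := hS i e ((hmem e).mp e.2) fun h => he0 (Subtype.ext h)
  have hle : cyc (s.ideal i) (e : T) ≤ N.toSubmodule.map (G.sub i).toSubmodule.subtype := by
    refine cyc_le ⟨e, he, rfl⟩ ?_
    rintro x hx _ ⟨m, hm, rfl⟩
    exact ⟨_, N.lie_mem (x := ⟨x, hx⟩) hm, rfl⟩
  have hle' := (cyc_le_cyc ht).trans hle
  refine eq_top_iff.mpr fun m _ => ?_
  obtain ⟨m', hm', h⟩ := hle' ((hmem m).mp m.2)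
  have : m' = m := Subtype.ext h
  rwa [← this]

theorem IsIrreducible.sub_eq_cyc {G : ModuleFiltration s T} (hG : G.IsIrreducible)
    {i : Fin (k + 1)} {t : T} (ht : t ∈ G.sub i) (ht0 : t ≠ 0) :
    (G.sub i).toSubmodule = cyc (s.ideal i) t := by
  have hle : cyc (s.ideal i) t ≤ (G.sub i).toSubmodule :=
    cyc_le ht fun x hx m hm => (G.sub i).lie_mem (x := ⟨x, hx⟩) hm
  refine le_antisymm ?_ hle
  let N : LieSubmodule K (s.ideal i) (G.sub i) :=
    { (cyc (s.ideal i) t).comap (G.sub i).toSubmodule.subtype with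
      lie_mem := fun {x m} hm => lie_mem_cyc x.2 hm }
  have hN : N ≠ ⊥ := fun hbot => by
    have hmem : (⟨t, ht⟩ : G.sub i) ∈ N := mem_cyc_self _ _
    rw [hbot, LieSubmodule.mem_bot] at hmem
    exact ht0 (congrArg Subtype.val hmem)
  have := hG i
  have htop := (eq_bot_or_eq_top N).resolve_left hN
  intro m hm
  have : (⟨m, hm⟩ : G.sub i) ∈ N := by rw [htop]; trivial
  exact this

theorem sub_le_sub (G : ModuleFiltration s T) {i j : Fin (k + 1)} (hij : i ≤ j) {t : T}
    (ht : t ∈ G.sub j) : t ∈ G.sub i := G.antitone i j hij ht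

/-- An irreducible module over `(g, s)` is generated by a vector of the last term. -/
theorem IsIrreducible.exists_gen {G : ModuleFiltration s T} (hG : G.IsIrreducible) :
    ∃ t ∈ G.sub (Fin.last k), t ≠ 0 ∧ (∀ i, (G.sub i).toSubmodule = cyc (s.ideal i) t) ∧
      ∀ i, LieFiltration.IsSimpleGen (s.ideal i) t := by
  have := hG (Fin.last k)
  have := LieModule.nontrivial_of_isIrreducible K (s.ideal (Fin.last k)) (G.sub (Fin.last k))
  obtain ⟨t, ht0⟩ := exists_ne (0 : G.sub (Fin.last k))
  have ht0' : (t : T) ≠ 0 := fun h => ht0 (Subtype.ext h)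
  have hcyc : ∀ i, (G.sub i).toSubmodule = cyc (s.ideal i) (t : T) := fun i =>
    hG.sub_eq_cyc (G.sub_le_sub (Fin.le_last i) t.2) ht0'
  refine ⟨t, t.2, ht0', hcyc, fun i e he he0 => ?_⟩
  rw [← hcyc i] at he
  rw [← hG.sub_eq_cyc he he0]
  exact G.sub_le_sub (Fin.le_last i) t.2

/-- The first isomorphism theorem with filtrations. The kernel enters through its membership
condition, so that the pulled-back submodule in `IsSubfactor` fits as well. -/
theorem quotient_equivalent (F : ModuleFiltration s V) (G : ModuleFiltration s T)
    (φ : V →ₗ⁅K, g⁆ T) (hφ : ∀ i, (F.sub i).toSubmodule.map (φ : V →ₗ[K] T) = (G.sub i).toSubmodule)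
    (Z : LieSubmodule K g V) (hZ : ∀ m, m ∈ Z ↔ φ m = 0) : (F.quotient Z).Equivalent G := by
  have hsurj : Function.Surjective φ := fun t => by
    have ht : t ∈ (G.sub 0).toSubmodule := by rw [G.sub_zero]; trivial
    rw [← hφ 0] at ht
    obtain ⟨m, -, rfl⟩ := ht
    exact ⟨m, rfl⟩
  let q : (V ⧸ Z) →ₗ[K] T := Z.toSubmodule.liftQ (φ : V →ₗ[K] T) fun m hm => (hZ m).mp hm
  have hq : ∀ m, q (Z.toSubmodule.mkQ m) = φ m := fun _ => rfl
  have hbij : Function.Bijective q := by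
    constructor
    · rw [← LinearMap.ker_eq_bot, LinearMap.ker_eq_bot']
      intro m
      obtain ⟨m, rfl⟩ := Z.toSubmodule.mkQ_surjective m
      intro hm
      exact (Submodule.Quotient.mk_eq_zero _).mpr ((hZ m).mpr hm)
    · intro t
      obtain ⟨m, rfl⟩ := hsurj t
      exact ⟨Z.toSubmodule.mkQ m, rfl⟩
  refine ⟨{ LinearEquiv.ofBijective q hbij with map_lie' := ?_ }, fun i => ?_⟩
  · intro x m
    obtain ⟨m, rfl⟩ := Z.toSubmodule.mkQ_surjective m
    exact LieModuleHom.map_lie φ x m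
  · rw [← hφ i]
    change ((F.sub i).toSubmodule.map Z.toSubmodule.mkQ).map q = _
    rw [← Submodule.map_comp]
    rfl

theorem isFactor_of_hom (F : ModuleFiltration s V) (G : ModuleFiltration s T) (φ : V →ₗ⁅K, g⁆ T)
    (hφ : ∀ i, (F.sub i).toSubmodule.map (φ : V →ₗ[K] T) = (G.sub i).toSubmodule) :
    F.IsFactor G :=
  ⟨φ.ker, F.quotient_equivalent G φ hφ _ fun _ => LieModuleHom.mem_ker⟩

theorem isSubfactor_of_hom (F : ModuleFiltration s V) (G : ModuleFiltration s T)
    (φ : V →ₗ⁅K, g⁆ T)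
    (hφ : ∀ i, (F.sub i).toSubmodule.map (φ : V →ₗ[K] T) = (G.sub i).toSubmodule) :
    F.IsSubfactor G := by
  refine ⟨⊤, φ.ker, le_top, (F.restrict ⊤).quotient_equivalent G
    (φ.comp (⊤ : LieSubmodule K g V).incl) (fun i => ?_) _ fun m => ?_⟩
  · rw [← hφ i]
    ext t
    constructor
    · rintro ⟨m, hm, rfl⟩
      exact ⟨m, hm, rfl⟩
    · rintro ⟨m, hm, rfl⟩
      exact ⟨⟨m, trivial⟩, hm, rfl⟩
  · rw [LieSubmodule.mem_comap, LieModuleHom.mem_ker]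
    rfl

theorem IsSubfactor.lie_eq_smul {F : ModuleFiltration s V} {G : ModuleFiltration s T}
    (hFG : F.IsSubfactor G) {i : Fin (k + 1)} {x : g} {c : K}
    (hF : ∀ m ∈ F.sub i, ⁅x, m⁆ = c • m) : ∀ t ∈ G.sub i, ⁅x, t⁆ = c • t := by
  obtain ⟨W, W', -, e, he⟩ := hFG
  intro t ht
  change t ∈ (G.sub i).toSubmodule at ht
  rw [← he i] at ht
  obtain ⟨_, ⟨m, hm, rfl⟩, rfl⟩ := ht
  have hm' : ⁅x, m⁆ = c • m := Subtype.ext (hF m hm)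
  change ⁅x, e _⁆ = c • e _
  rw [← LieModuleEquiv.coe_toLieModuleHom, ← LieModuleHom.map_lie, ← map_smul, ← map_smul, ← hm']
  rfl

end ModuleFiltration

namespace LieFiltration

variable (s : LieFiltration K g k) (h : LieSubalgebra K g) (η : Module.Dual K h)

/-- The canonical generator of `ind(N_s(η), g)`. -/
noncomputable def indGen : Ind h ((s.restrict h).M η) := Ind.oneTmul h ((s.restrict h).gen η)

theorem ind_filtM_sub_eq_cyc (i : Fin (k + 1)) :
    (((s.restrict h).filtM η).ind.sub i).toSubmodule = cyc (s.ideal i) (s.indGen h η) :=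
  ModuleFiltration.ind_sub_eq_cyc _ ((s.restrict h).filtM_sub_eq_cyc η) i

theorem lie_indGen {p : h} (hp : p ∈ (s.restrict h).vergne η) :
    ⁅(p : g), s.indGen h η⁆ = η p • s.indGen h η := by
  rw [indGen, Ind.lie_oneTmul, lie_gen _ _ hp, map_smul]

variable {T : Type w} [AddCommGroup T] [Module K T] [LieRingModule g T] [LieModule K g T]

theorem exists_hom_ind {t : T} (ht : ∀ p ∈ (s.restrict h).vergne η, ⁅(p : g), t⁆ = η p • t) :
    ∃ φ : Ind h ((s.restrict h).M η) →ₗ⁅K, g⁆ T, φ (s.indGen h η) = t := by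
  obtain ⟨ψ, hψ⟩ := (s.restrict h).exists_hom_of_lie_eq η (T := T) (t := t) ht
  obtain ⟨φ, hφ⟩ := Ind.exists_lift (h := h) (ψ : (s.restrict h).M η →ₗ[K] T)
    fun x y => LieModuleHom.map_lie ψ x y
  exact ⟨φ, (hφ _).trans hψ⟩

/-- As `g_k = 0`, the last term of the induced module is the line through `indGen`; the scalar
action there passes to subfactors. -/
theorem lie_eq_smul_of_memSpec {G : ModuleFiltration s T}
    (hG : ((s.restrict h).filtM η).ind.MemSpec G) :
    ∀ p ∈ (s.restrict h).vergne η, ∀ t ∈ G.sub (Fin.last k), ⁅(p : g), t⁆ = η p • t := by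
  intro p hp
  refine hG.2.lie_eq_smul fun m hm => ?_
  have hle : cyc (s.ideal (Fin.last k)) (s.indGen h η) ≤ K ∙ s.indGen h η := by
    refine cyc_le (Submodule.mem_span_singleton_self _) fun x hx m _ => ?_
    rw [s.eq_zero_of_mem_ideal_last hx, zero_lie]
    exact zero_mem _
  rw [← ind_filtM_sub_eq_cyc] at hle
  obtain ⟨c, rfl⟩ := Submodule.mem_span_singleton.mp (hle hm)
  rw [lie_smul, s.lie_indGen h η hp, smul_comm]

theorem map_sub_of_gen {V : Type w'} [AddCommGroup V] [Module K V] [LieRingModule g V]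
    [LieModule K g V] {s : LieFiltration K g k} {F : ModuleFiltration s V}
    {G : ModuleFiltration s T} {m : V} {t : T}
    (hF : ∀ i, (F.sub i).toSubmodule = cyc (s.ideal i) m)
    (hG : ∀ i, (G.sub i).toSubmodule = cyc (s.ideal i) t) {φ : V →ₗ⁅K, g⁆ T} (hφ : φ m = t)
    (i : Fin (k + 1)) : (F.sub i).toSubmodule.map (φ : V →ₗ[K] T) = (G.sub i).toSubmodule := by
  rw [hF, hG, map_cyc, hφ]

variable {s h η}

theorem isFactor_of_memSpec {G : ModuleFiltration s T}
    (hG : ((s.restrict h).filtM η).ind.MemSpec G) : ((s.restrict h).filtM η).ind.IsFactor G := by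
  obtain ⟨t, ht, -, hcyc, -⟩ := hG.1.exists_gen
  obtain ⟨φ, hφ⟩ := s.exists_hom_ind h η (t := t)
    fun p hp => s.lie_eq_smul_of_memSpec h η hG p hp t ht
  exact ModuleFiltration.isFactor_of_hom _ G φ
    (map_sub_of_gen (s.ind_filtM_sub_eq_cyc h η) hcyc hφ)

theorem exists_gen_of_equivalent {G : ModuleFiltration s T} {f : Module.Dual K g}
    (hG : G.Equivalent (s.filtM f)) : ∃ t : T, t ≠ 0 ∧
      (∀ i, (G.sub i).toSubmodule = cyc (s.ideal i) t) ∧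
      ∀ p ∈ s.vergne f, ⁅p, t⁆ = f p • t := by
  obtain ⟨e, he⟩ := hG
  have het : e (e.symm (s.gen f)) = s.gen f := e.apply_symm_apply _
  refine ⟨e.symm (s.gen f), fun h0 => s.gen_ne_zero f ?_, fun i => ?_, fun p hp => ?_⟩
  · rw [← het, h0]
    exact map_zero (e.toLinearEquiv : T →ₗ[K] s.M f)
  · apply Submodule.map_injective_of_injective e.injective
    refine (he i).trans ?_
    rw [filtM_sub_eq_cyc]
    refine Eq.trans ?_ (map_cyc e.toLieModuleHom _ _).symm
    exact congrArg _ het.symm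
  · apply e.injective
    change e.toLieModuleHom _ = e.toLieModuleHom _
    rw [LieModuleHom.map_lie, map_smul]
    change ⁅p, e (e.symm _)⁆ = f p • e (e.symm _)
    rw [het, s.lie_gen f hp]

variable [CharZero K]

theorem memSpec_iff {G : ModuleFiltration s T} {f : Module.Dual K g} {t : T} (ht0 : t ≠ 0)
    (hG : ∀ i, (G.sub i).toSubmodule = cyc (s.ideal i) t)
    (ht : ∀ p ∈ s.vergne f, ⁅p, t⁆ = f p • t) :
    ((s.restrict h).filtM η).ind.MemSpec G ↔
      s.relClass f ⊆ dualProj h ⁻¹' (s.restrict h).relClass η := by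
  have hw : ∀ i, s.IsWeight f (s.ideal i) t := fun i p hp _ => ht p hp
  have htG : ∀ i, t ∈ G.sub i := fun i => by
    change t ∈ (G.sub i).toSubmodule
    rw [hG i]
    exact mem_cyc_self _ _
  constructor
  · intro hS f' hf'
    have hηf : ∀ p ∈ (s.restrict h).vergne η, (p : g) ∈ s.vergne f ∧ f p = η p := by
      intro p hp
      have hpt := s.lie_eq_smul_of_memSpec h η hS p hp t (htG _)
      have hpf := s.mem_vergne_of_lie_eq_smul f ht0 0 (hw 0) p (s.mem_ideal_zero _) _ hpt
      refine ⟨hpf, ?_⟩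
      rw [ht p hpf, ← sub_eq_zero, ← sub_smul] at hpt
      exact sub_eq_zero.mp ((smul_eq_zero.mp hpt).resolve_right ht0)
    have heq : ∀ p ∈ (s.restrict h).vergne η, dualProj h f' p = η p := fun p hp =>
      (hf'.2 p (hηf p hp).1).trans (hηf p hp).2
    exact ⟨(s.restrict h).vergne_eq_of_eqOn heq, heq⟩
  · intro hR
    have hf : f ∈ s.relClass f := ⟨rfl, fun _ _ => rfl⟩
    have hηf : ∀ p ∈ (s.restrict h).vergne η, (p : g) ∈ s.vergne f := by
      intro p hp
      by_contra hpf
      -- Adding a form that vanishes on `pv(f)` but not at `p` stays in the class of `f` and changes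
      -- the value at `p`, which the hypothesis fixes to be `η p`.
      obtain ⟨l, hl, hl'⟩ := Submodule.exists_dual_map_eq_bot_of_notMem
        (p := (s.vergne f).toSubmodule) hpf inferInstance
      have hfl : ∀ x ∈ s.vergne f, (f + l) x = f x := fun x hx => by
        have : l x ∈ (s.vergne f).toSubmodule.map l := ⟨x, hx, rfl⟩
        rw [hl', Submodule.mem_bot] at this
        rw [LinearMap.add_apply, this, add_zero]
      have h1 : (f + l) p = η p := (hR ⟨s.vergne_eq_of_eqOn hfl, hfl⟩).2 p hp
      have h2 : f p = η p := (hR hf).2 p hp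
      rw [LinearMap.add_apply, h2, add_eq_left] at h1
      exact hl h1
    obtain ⟨φ, hφ⟩ := s.exists_hom_ind h η (t := t) fun p hp => by
      have h2 : f p = η p := (hR hf).2 p hp
      rw [ht p (hηf p hp), h2]
    exact ⟨G.isIrreducible_of_sub_eq_cyc ht0 hG fun i => s.isSimpleGen f ht0 i (hw i),
      ModuleFiltration.isSubfactor_of_hom _ G φ
        (map_sub_of_gen (s.ind_filtM_sub_eq_cyc h η) hG hφ)⟩

/-- The map `gen ↦ t` is injective: a nonzero kernel element would generate `gen`, forcing `t = 0`.
-/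
theorem equivalent_filtM {G : ModuleFiltration s T} {f : Module.Dual K g} {t : T} (ht0 : t ≠ 0)
    (hG : ∀ i, (G.sub i).toSubmodule = cyc (s.ideal i) t)
    (ht : ∀ p ∈ s.vergne f, ⁅p, t⁆ = f p • t) : G.Equivalent (s.filtM f) := by
  obtain ⟨φ, hφ⟩ := s.exists_hom_of_lie_eq f ht
  have hmap := map_sub_of_gen (s.filtM_sub_eq_cyc f) hG hφ
  have hinj : Function.Injective (φ : s.M f →ₗ[K] T) := by
    rw [← LinearMap.ker_eq_bot, LinearMap.ker_eq_bot']
    intro e he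
    by_contra he0
    have hmem : e ∈ cyc (s.ideal 0) (s.gen f) := by
      rw [← filtM_sub_eq_cyc, (s.filtM f).sub_zero]
      trivial
    have hgen := s.isSimpleGen f (s.gen_ne_zero f) 0 (fun p hp _ => s.lie_gen f hp) e hmem he0
    have : φ (s.gen f) ∈ (cyc (s.ideal 0) e).map (φ : s.M f →ₗ[K] T) := ⟨_, hgen, rfl⟩
    rw [map_cyc, show φ e = 0 from he, cyc_zero, Submodule.mem_bot, hφ] at this
    exact ht0 this
  have hsurj : Function.Surjective (φ : s.M f →ₗ[K] T) := by
    rw [← LinearMap.range_eq_top, ← Submodule.map_top, ← (s.filtM f).sub_zero, hmap, G.sub_zero]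
  let e : s.M f ≃ₗ⁅K, g⁆ T :=
    { LinearEquiv.ofBijective (φ : s.M f →ₗ[K] T) ⟨hinj, hsurj⟩ with
      map_lie' := fun {x m} => LieModuleHom.map_lie φ x m }
  refine ⟨e.symm, fun i => ?_⟩
  rw [← hmap i]
  ext m
  constructor
  · rintro ⟨_, ⟨a, ha, rfl⟩, rfl⟩
    change e.symm (e a) ∈ _
    rw [LieModuleEquiv.symm_apply_apply]
    exact ha
  · intro hm
    exact ⟨e m, ⟨m, hm, rfl⟩, e.symm_apply_apply m⟩

end LieFiltration

end Vergne
theorem theorem4p3 {K : Type u} [Field K] [CharZero K] {g : Type v} [LieRing g] [LieAlgebra K g]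
    {k : ℕ} (s : LieFiltration K g k) (h : LieSubalgebra K g) (η : Module.Dual K h) :
    -- which of the `M_s(f)` belong to the spectrum of `ind(N_s(η), g)`
    (∀ f : Module.Dual K g,
      ((s.restrict h).filtM η).ind.MemSpec (s.filtM f) ↔
        s.relClass f ⊆ dualProj h ⁻¹' (s.restrict h).relClass η) ∧
    -- every irreducible subfactor of `ind(N_s(η), g)` is a factor
    (∀ {T : Type w} [AddCommGroup T] [Module K T] [LieRingModule g T] [LieModule K g T]
      (G : ModuleFiltration s T),
      ((s.restrict h).filtM η).ind.MemSpec G → ((s.restrict h).filtM η).ind.IsFactor G) ∧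
    -- over an algebraically closed field, the spectrum consists of these `M_s(f)` only
    (IsAlgClosed K →
      ∀ {T : Type w} [AddCommGroup T] [Module K T] [LieRingModule g T] [LieModule K g T]
        (G : ModuleFiltration s T),
        ((s.restrict h).filtM η).ind.MemSpec G ↔
          ∃ f : Module.Dual K g, G.Equivalent (s.filtM f) ∧
            s.relClass f ⊆ dualProj h ⁻¹' (s.restrict h).relClass η) := by

  refine ⟨fun f => LieFiltration.memSpec_iff (s.gen_ne_zero f) (s.filtM_sub_eq_cyc f)
    fun p hp => s.lie_gen f hp, fun G hG => LieFiltration.isFactor_of_memSpec hG,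
    fun hK T _ _ _ _ G => ⟨fun hG => ?_, ?_⟩⟩
  · obtain ⟨t, -, ht0, hcyc, hS⟩ := hG.1.exists_gen
    obtain ⟨f, hf⟩ := s.exists_isWeight_of_isSimpleGen ht0 hS
    exact ⟨f, LieFiltration.equivalent_filtM ht0 hcyc hf,
      (LieFiltration.memSpec_iff ht0 hcyc hf).mp hG⟩
  · rintro ⟨f, hG, hR⟩
    obtain ⟨t, ht0, hcyc, ht⟩ := LieFiltration.exists_gen_of_equivalent hG
    exact (LieFiltration.memSpec_iff ht0 hcyc ht).mpr hR
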